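/- Let $G$ be a graph of type $ADE$ with finite vertex set $I$: a finite simple graph such that the symmetric bilinear form on the real vector space $E$ with basis $(\alpha_i)_{i\in I}$ given by $(\alpha_i,\alpha_i)=2$, $(\alpha_i,\alpha_j)=-1$ if $i,j$ are joined and $(\alpha_i,\alpha_j)=0$ if $i\neq j$ are not joined, is positive definite. Let $(\varpi_i)$ be the basis of $E$ with $(\varpi_i,\alpha_j)=\delta_{ij}$, and write $\xi=\sum_i({}^i\xi)\varpi_i$. Put $P=\sum_i\mathbb Z\varpi_i$, $P^+=\sum_i\mathbb N\varpi_i$ and $\rho=\sum_i\varpi_i$. For $\xi,\xi'\in P$ write $\xi\le\xi'$ if $\xi'-\xi\in\sum_i\mathbb N\alpha_i$. Let $W$ be the finite group generated by the reflections $s_i(\xi)=\xi-(\xi,\alpha_i)\alpha_i$. For $\lambda\in P^+$ let $V_\lambda\in\mathbb Z[P]$ be the element defined by Weyl's formula $$\sum_{w\in W}\det(w)[w(\lambda+\rho)]=V_\lambda\sum_{w\in W}\det(w)[w(\rho)],$$ and let $(\xi:V_\lambda)$ be the coefficient of $[\xi]$ in $V_\lambda$. For $p,m\in\mathbb N$ let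 $$\begin{bmatrix}p+m\\ m\end{bmatrix}=\frac{(q^{p+1}-1)\cdots(q^{p+m}-1)}{(q-1)\cdots(q^m-1)}\in\mathbb Z[q].$$ For $\nu,\lambda\in P^+$ define $$M(\nu,\lambda,q)=\sum_{\{m\}}q^{c(\{m\})}\prod_{i\in I,\,k\ge1}\begin{bmatrix}p_k^{(i)}+m_k^{(i)}\\ m_k^{(i)}\end{bmatrix},$$ where $$c(\{m\})=\tfrac12\sum_{i,j\in I}(\alpha_i,\alpha_j)\sum_{k,l\ge1}\min(k,l)\,m_k^{(i)}m_l^{(j)}-\sum_{i\in I}\sum_{k\ge1}({}^i\nu)\,m_k^{(i)},$$ $$p_k^{(i)}={}^i\nu-\sum_{j\in I}(\alpha_i,\alpha_j)\sum_{l\ge1}\min(k,l)\,m_l^{(j)},$$ and the sum is over the families $(m_k^{(i)})_{i\in I,\,k\ge1}$ in $\mathbb N$ with finitely many nonzero members such that $p_k^{(i)}\ge0$ for all $i\in I$, $k\ge1$ and $\sum_{i\in I}\sum_{k\ge1}k\,m_k^{(i)}\alpha_i=\nu-\lambda$. Let $\nu\in P^+$. For $\xi\in P$ let $$R_\xi(q)=\sum_{\lambda\in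 P^+}(\xi:V_\lambda)\,q^{(\nu,\nu)/2-(\xi,\xi)/2}\,M(\nu,\lambda,q),$$ a priori a combination of powers of $q$ with rational exponents. Then: 1. $R_\xi\in\mathbb N[q]$ for every $\xi\in P$. 2. If $\xi\in P$ and $(\xi:V_\nu)\neq0$, then the constant term of $R_\xi$ is $1$. 3. If $\xi\in P^+$ and $\xi\le\nu$, then the constant term of $R_\xi$ is $1$ and $R_\xi$ has degree exactly $(\nu,\nu)/2-(\xi,\xi)/2$. -/

import Mathlib

open scoped Polynomial

noncomputable section

namespace FermionicForm

/-! ### The root datum of a simply laced graph -/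

section RootDatum

variable {I : Type*} [Fintype I] [DecidableEq I]

/-- The integers `(α i, α j)`: `2` if `i = j`, `-1` if `i`, `j` are joined, `0` otherwise. -/
def cartan (G : SimpleGraph I) [DecidableRel G.Adj] : Matrix I I ℤ :=
  Matrix.of fun i j => if i = j then 2 else if G.Adj i j then -1 else 0

/-- The graph is of type ADE: the symmetric bilinear form with Gram matrix `cartan G` on the real
vector space with basis `α i` is positive definite. As is well known, this holds exactly for the
finite graphs all of whose components are Dynkin graphs of type `A`, `D` or `E`; that the
irreducible graphs of type `A`, `D`, `E` satisfy it is proved in `isADE_A`, `isADE_D`, `isADE_E₆`,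
`isADE_E₇`, `isADE_E₈` below. -/
def IsADE (G : SimpleGraph I) [DecidableRel G.Adj] : Prop :=
  ((cartan G).map (Int.cast : ℤ → ℝ)).PosDef

/-- The weight lattice `P`: the weight `ξ = ∑ i, (ξ i) ϖ i` is given by its integer coordinates in
the basis `ϖ` dual to the basis `α` of simple roots, so that `ξ i = (ξ, α i)`. -/
abbrev Weight (I : Type*) := I → ℤ

/-- `ξ ∈ P⁺`. -/
def IsDominant (ξ : Weight I) : Prop := ∀ i, 0 ≤ ξ i

/-- The simple root `α j`; its `i`-th coordinate is `(α j, α i)`. -/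
def simpleRoot (G : SimpleGraph I) [DecidableRel G.Adj] (j : I) : Weight I :=
  fun i => cartan G j i

/-- `ρ = ∑ i, ϖ i`. -/
def rho : Weight I := fun _ => 1

/-- The usual partial order on `P`: `ξ ≤ ξ'` if `ξ' - ξ` is a combination of simple roots with
coefficients in `ℕ`. (This is not the coordinatewise order of `I → ℤ`.) -/
def WeightLE (G : SimpleGraph I) [DecidableRel G.Adj] (ξ ξ' : Weight I) : Prop :=
  ∃ n : I → ℕ, ξ' - ξ = ∑ i, n i • simpleRoot G i

/-- The bilinear form on `P`. The Gram matrix of the basis `ϖ`, which is dual to `α`, is the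
inverse of the Gram matrix of `α`. -/
def form (G : SimpleGraph I) [DecidableRel G.Adj] (ξ η : Weight I) : ℚ :=
  ∑ i, ∑ j, (ξ i : ℚ) * ((cartan G).map (Int.cast : ℤ → ℚ))⁻¹ i j * (η j : ℚ)

theorem proj_simpleRoot (G : SimpleGraph I) [DecidableRel G.Adj] (i : I) :
    (LinearMap.proj i : Weight I →ₗ[ℤ] ℤ) (simpleRoot G i) = 2 := by
  simp [simpleRoot, cartan]

/-- The simple reflection `s i : ξ ↦ ξ - (ξ, α i) α i`. -/
def simpleReflection (G : SimpleGraph I) [DecidableRel G.Adj] (i : I) :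
    Weight I ≃ₗ[ℤ] Weight I :=
  Module.reflection (proj_simpleRoot G i)

/-- The Weyl group `W`, acting on `P`. -/
def weylGroup (G : SimpleGraph I) [DecidableRel G.Adj] : Subgroup (Weight I ≃ₗ[ℤ] Weight I) :=
  Subgroup.closure (Set.range (simpleReflection G))

/-- `∑ w ∈ W, det(w) [w ξ]` in the group ring `ℤ[P]`. -/
def alternant (G : SimpleGraph I) [DecidableRel G.Adj] (ξ : Weight I) :
    AddMonoidAlgebra ℤ (Weight I) :=
  ∑ᶠ w : weylGroup G,
    AddMonoidAlgebra.single ((w : Weight I ≃ₗ[ℤ] Weight I) ξ)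
      ((LinearEquiv.det (w : Weight I ≃ₗ[ℤ] Weight I) : ℤˣ) : ℤ)

open Classical in
/-- `V_ξ ∈ ℤ[P]`, the element that satisfies Weyl's formula
`∑ w, det(w) [w (ξ + ρ)] = V_ξ * ∑ w, det(w) [w ρ]`. -/
def weylCharacter (G : SimpleGraph I) [DecidableRel G.Adj] (ξ : Weight I) :
    AddMonoidAlgebra ℤ (Weight I) :=
  if h : ∃ V, alternant G (ξ + rho) = V * alternant G rho then h.choose else 0

/-- `(ξ : V_lam)`, the coefficient of `[ξ]` in `V_lam`. -/
def weightMult (G : SimpleGraph I) [DecidableRel G.Adj] (ξ lam : Weight I) : ℤ :=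
  (weylCharacter G lam).coeff ξ

/-- The weight `∑ i, (ξ i) ϖ i` has `(ξ, α i) = ξ i`, that is, `ϖ` is dual to `α`. -/
theorem form_simpleRoot (G : SimpleGraph I) [DecidableRel G.Adj] (hG : IsADE G) (ξ : Weight I)
    (i : I) : form G ξ (simpleRoot G i) = ξ i := by
  have hdet : IsUnit ((cartan G).map (Int.cast : ℤ → ℚ)).det := by
    have h1 := hG.det_pos
    rw [isUnit_iff_ne_zero]
    have h2 : ((cartan G).map (Int.cast : ℤ → ℝ)).det = ((cartan G).det : ℝ) :=
      ((Int.castRingHom ℝ).map_det (cartan G)).symm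
    have h3 : ((cartan G).map (Int.cast : ℤ → ℚ)).det = ((cartan G).det : ℚ) :=
      ((Int.castRingHom ℚ).map_det (cartan G)).symm
    rw [h2] at h1
    rw [h3]
    have : (cartan G).det ≠ 0 := by
      intro h; simp [h] at h1
    exact_mod_cast this
  have hs : ∀ j, cartan G i j = cartan G j i := by
    intro j; simp [cartan, eq_comm, G.adj_comm]
  have hm := Matrix.nonsing_inv_mul _ hdet
  have : ∀ k, ∑ j, ((cartan G).map (Int.cast : ℤ → ℚ))⁻¹ k j * (cartan G j i : ℚ) =
      if k = i then 1 else 0 := by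
    intro k
    simpa [Matrix.mul_apply, Matrix.one_apply] using congrFun (congrFun hm k) i
  simp only [form, simpleRoot, hs, mul_assoc, ← Finset.mul_sum, this]
  simp

/-- The Gram matrix of the simple roots is the prescribed one. -/
theorem form_simpleRoot_simpleRoot (G : SimpleGraph I) [DecidableRel G.Adj] (hG : IsADE G)
    (i j : I) : form G (simpleRoot G i) (simpleRoot G j) = cartan G i j := by
  rw [form_simpleRoot G hG, simpleRoot]

end RootDatum

/-! ### The graphs of type `A`, `D`, `E` satisfy `IsADE` -/

section ADE

variable {I : Type*} [DecidableEq I]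

theorem isADE_of_factor {n : ℕ} {κ : Type*} [Fintype κ] (G : SimpleGraph I) [DecidableRel G.Adj]
    (C : Matrix (Fin n) (Fin n) ℤ) (e : I → Fin n) (he : Function.Injective e)
    (h : ∀ i j, cartan G i j = C (e i) (e j))
    (B : Matrix κ (Fin n) ℤ) (V : Matrix (Fin n) κ ℤ) (c d : ℤ) (hc : 0 < c) (hd : d ≠ 0)
    (hB : B.transpose * B = c • C) (hV : V * B = d • (1 : Matrix (Fin n) (Fin n) ℤ)) :
    IsADE G := by
  have hmap : (cartan G).map (Int.cast : ℤ → ℝ) =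
      (C.map (Int.cast : ℤ → ℝ)).submatrix e e := by
    ext i j; simp [h]
  rw [IsADE, hmap]
  refine Matrix.PosDef.submatrix ?_ he
  have hB' : (B.map (Int.cast : ℤ → ℝ)).conjTranspose * B.map (Int.cast : ℤ → ℝ) =
      (c : ℝ) • C.map (Int.cast : ℤ → ℝ) := by
    ext i j
    have := congrArg (Int.cast : ℤ → ℝ) (congrFun (congrFun hB i) j)
    simpa [Matrix.mul_apply] using this
  have hV' : V.map (Int.cast : ℤ → ℝ) * B.map (Int.cast : ℤ → ℝ) =
      (d : ℝ) • (1 : Matrix (Fin n) (Fin n) ℝ) := by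
    ext i j
    have := congrArg (Int.cast : ℤ → ℝ) (congrFun (congrFun hV i) j)
    simpa [Matrix.mul_apply, Matrix.one_apply] using this
  have hd' : (d : ℝ) ≠ 0 := by exact_mod_cast hd
  have hc' : (0 : ℝ) < c := by exact_mod_cast hc
  have hinj : Function.Injective (B.map (Int.cast : ℤ → ℝ)).mulVec := by
    intro x y hxy
    have := congrArg (V.map (Int.cast : ℤ → ℝ)).mulVec hxy
    simp only [Matrix.mulVec_mulVec, hV', Matrix.smul_mulVec, Matrix.one_mulVec] at this
    exact smul_right_injective _ hd' this
  have hp := (Matrix.PosDef.conjTranspose_mul_self _ hinj).smul (inv_pos.2 hc')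
  rwa [hB', smul_smul, inv_mul_cancel₀ hc'.ne', one_smul] at hp

theorem sum_mul_pair {κ : Type*} [Fintype κ] [DecidableEq κ] (f : κ → ℤ) (a b : κ) (s : ℤ) :
    ∑ k, f k * ((if k = a then 1 else 0) + s * (if k = b then 1 else 0)) = f a + s * f b := by
  simp [mul_add, Finset.sum_add_distrib, mul_comm]

theorem isADE_A {n : ℕ} (G : SimpleGraph I) [DecidableRel G.Adj] (e : I ≃ Fin n)
    (h : ∀ i j, cartan G i j = CartanMatrix.A n (e i) (e j)) : IsADE G := by
  refine isADE_of_factor G _ e e.injective h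
    (Matrix.of fun (k : Fin (n + 1)) (i : Fin n) =>
      (if k = i.castSucc then 1 else 0) + (-1) * (if k = i.succ then 1 else 0))
    (Matrix.of fun (i : Fin n) (k : Fin (n + 1)) => if k ≤ i.castSucc then 1 else 0)
    1 1 one_pos one_ne_zero ?_ ?_
  · ext i j
    simp only [Matrix.mul_apply, Matrix.of_apply, Matrix.transpose_apply, sum_mul_pair]
    simp only [CartanMatrix.A, Matrix.of_apply, Matrix.smul_apply, one_smul, Fin.ext_iff, Fin.val_castSucc, Fin.val_succ]
    split_ifs <;> omega
  · ext i j
    simp only [Matrix.mul_apply, Matrix.of_apply, sum_mul_pair]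
    simp only [one_smul, Matrix.one_apply,
      Fin.ext_iff, Fin.le_def, Fin.val_castSucc, Fin.val_succ]
    split_ifs <;> omega

theorem isADE_D {n : ℕ} (hn : 3 ≤ n) (G : SimpleGraph I) [DecidableRel G.Adj] (e : I ≃ Fin n)
    (h : ∀ i j, cartan G i j = CartanMatrix.D n (e i) (e j)) : IsADE G := by
  refine isADE_of_factor G _ e e.injective h
    (Matrix.of fun (k i : Fin n) =>
      (if k = ⟨if i.1 + 1 = n then n - 2 else i.1, by split_ifs <;> omega⟩ then 1 else 0) +
      (if i.1 + 1 = n then 1 else -1) *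
        (if k = ⟨if i.1 + 1 = n then n - 1 else i.1 + 1, by split_ifs <;> omega⟩ then 1 else 0))
    (Matrix.of fun (i k : Fin n) => if i.1 + 2 < n then (if k.1 ≤ i.1 then 2 else 0)
      else if i.1 + 2 = n then (if k.1 + 1 = n then -1 else 1) else 1)
    1 2 one_pos two_ne_zero ?_ ?_
  · ext i j
    have hi := i.2
    have hj := j.2
    simp only [Matrix.mul_apply, Matrix.of_apply, Matrix.transpose_apply, sum_mul_pair]
    simp only [CartanMatrix.D, Matrix.of_apply, one_smul, Fin.ext_iff, Matrix.smul_apply]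
    by_cases h1 : i.1 + 1 = n <;> by_cases h2 : j.1 + 1 = n <;> simp only [h1, h2, if_true, if_false]
      <;> grind
  · ext i j
    have hi := i.2
    have hj := j.2
    simp only [Matrix.mul_apply, Matrix.of_apply, sum_mul_pair]
    simp only [Matrix.smul_apply, Matrix.one_apply, Fin.ext_iff]
    by_cases h2 : j.1 + 1 = n <;> simp only [h2, if_true, if_false] <;> grind

/-- This covers `E₆`, `E₇` and `E₈`: their Cartan matrices are the leading blocks of that of
`E₈`. -/
theorem isADE_of_E₈ (G : SimpleGraph I) [DecidableRel G.Adj] (e : I → Fin 8)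
    (he : Function.Injective e)
    (h : ∀ i j, cartan G i j = CartanMatrix.E₈ (e i) (e j)) : IsADE G :=
  isADE_of_factor G _ e he h
    !![1, 2, -2, 0, 0, 0, 0, 0;
      -1, 2, 2, -2, 0, 0, 0, 0;
      -1, 0, 0, 2, -2, 0, 0, 0;
      -1, 0, 0, 0, 2, -2, 0, 0;
      -1, 0, 0, 0, 0, 2, -2, 0;
      -1, 0, 0, 0, 0, 0, 2, -2;
      -1, 0, 0, 0, 0, 0, 0, 2;
      1, 0, 0, 0, 0, 0, 0, 0]
    !![0, 0, 0, 0, 0, 0, 0, 4;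
      1, 1, 1, 1, 1, 1, 1, 5;
      -1, 1, 1, 1, 1, 1, 1, 7;
      0, 0, 2, 2, 2, 2, 2, 10;
      0, 0, 0, 2, 2, 2, 2, 8;
      0, 0, 0, 0, 2, 2, 2, 6;
      0, 0, 0, 0, 0, 2, 2, 4;
      0, 0, 0, 0, 0, 0, 2, 2]
    4 4 (by norm_num) (by norm_num) (by decide) (by decide)

theorem isADE_E₈ (G : SimpleGraph I) [DecidableRel G.Adj] (e : I ≃ Fin 8)
    (h : ∀ i j, cartan G i j = CartanMatrix.E₈ (e i) (e j)) : IsADE G :=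
  isADE_of_E₈ G e e.injective h

theorem isADE_E₇ (G : SimpleGraph I) [DecidableRel G.Adj] (e : I ≃ Fin 7)
    (h : ∀ i j, cartan G i j = CartanMatrix.E₇ (e i) (e j)) : IsADE G := by
  have hE : ∀ a b : Fin 7, CartanMatrix.E₇ a b = CartanMatrix.E₈ a.castSucc b.castSucc := by
    intro a b; fin_cases a <;> fin_cases b <;> rfl
  exact isADE_of_E₈ G (fun i => (e i).castSucc)
    ((Fin.castSucc_injective 7).comp e.injective) fun i j => (h i j).trans (hE _ _)

theorem isADE_E₆ (G : SimpleGraph I) [DecidableRel G.Adj] (e : I ≃ Fin 6)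
    (h : ∀ i j, cartan G i j = CartanMatrix.E₆ (e i) (e j)) : IsADE G := by
  have hE : ∀ a b : Fin 6, CartanMatrix.E₆ a b =
      CartanMatrix.E₈ a.castSucc.castSucc b.castSucc.castSucc := by
    intro a b; fin_cases a <;> fin_cases b <;> rfl
  exact isADE_of_E₈ G (fun i => (e i).castSucc.castSucc)
    ((Fin.castSucc_injective 7).comp ((Fin.castSucc_injective 6).comp e.injective))
    fun i j => (h i j).trans (hE _ _)

end ADE

/-! ### Gaussian binomial coefficients -/

section Gauss

open Polynomial Finset

/-- `(q^(p+1) - 1)(q^(p+2) - 1) ⋯ (q^(p+m) - 1)`. -/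
def gaussNum (p m : ℕ) : ℤ[X] := ∏ j ∈ range m, (X ^ (p + j + 1) - 1)

/-- `(q - 1)(q^2 - 1) ⋯ (q^m - 1)`. -/
def gaussDen (m : ℕ) : ℤ[X] := ∏ j ∈ range m, (X ^ (j + 1) - 1)

/-- The `q`-binomial coefficient `[p + m, m] ∈ ℤ[q]`: the quotient of `gaussNum p m` by the monic
polynomial `gaussDen m`; the division is exact, see `gaussBinom_mul_gaussDen`. -/
def gaussBinom (p m : ℕ) : ℤ[X] := gaussNum p m /ₘ gaussDen m

theorem gaussDen_monic (m : ℕ) : (gaussDen m).Monic :=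
  monic_prod_of_monic _ _ fun j _ => by
    simpa using monic_X_pow_sub_C (1 : ℤ) (Nat.succ_ne_zero j)

theorem gaussDen_dvd_gaussNum (p m : ℕ) : gaussDen m ∣ gaussNum p m := by
  induction m generalizing p with
  | zero => simp [gaussDen, gaussNum]
  | succ m ihm =>
    induction p with
    | zero => simp [gaussDen, gaussNum]
    | succ p ihp =>
      have h1 : gaussNum (p + 1) (m + 1) = (X ^ (p + m + 2) - 1) * gaussNum (p + 1) m := by
        rw [gaussNum, prod_range_succ, mul_comm, gaussNum]; congr 3; ring
      have h2 : gaussNum p (m + 1) = (X ^ (p + 1) - 1) * gaussNum (p + 1) m := by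
        rw [gaussNum, prod_range_succ', mul_comm, gaussNum]; congr 1
        exact prod_congr rfl fun j _ => by congr 2; ring
      have h3 : gaussNum (p + 1) (m + 1) =
          X ^ (m + 1) * gaussNum p (m + 1) + gaussNum (p + 1) m * (X ^ (m + 1) - 1) := by
        rw [h1, h2]; ring
      rw [h3]
      refine dvd_add (ihp.mul_left _) ?_
      rw [gaussDen, prod_range_succ]
      exact mul_dvd_mul_right (ihm _) _

theorem gaussBinom_mul_gaussDen (p m : ℕ) : gaussBinom p m * gaussDen m = gaussNum p m := by
  have h := modByMonic_add_div (gaussNum p m) (gaussDen m)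
  rw [(modByMonic_eq_zero_iff_dvd (gaussDen_monic m)).2 (gaussDen_dvd_gaussNum p m), zero_add] at h
  rw [gaussBinom, mul_comm, h]

end Gauss

/-! ### The fermionic form -/

section Fermionic

variable {I : Type*} [Fintype I] [DecidableEq I]

/-- Integer combinations of the powers `q^x`, `x ∈ ℚ`. Fractional exponents are allowed because
`(ν, ν) / 2 - (ξ, ξ) / 2` is not an integer for all weights `ν`, `ξ`. -/
abbrev QRing := AddMonoidAlgebra ℤ ℚ

/-- The monomial `q^x`. -/
def qPow (x : ℚ) : QRing := AddMonoidAlgebra.single x 1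

/-- A family `m_k^{(i)} ∈ ℕ` (`i ∈ I`, `k ≥ 1`), almost all of whose members are zero. -/
abbrev Config (I : Type*) := (I × ℕ+) →₀ ℕ

/-- The exponent `c({m}) = 1/2 ∑_{i,j} (α i, α j) ∑_{k,l ≥ 1} min(k,l) m_k^{(i)} m_l^{(j)}
- ∑_i ∑_{k ≥ 1} (ν i) m_k^{(i)}`. -/
def charge (G : SimpleGraph I) [DecidableRel G.Adj] (ν : Weight I) (m : Config I) : ℚ :=
  (1 / 2) * (m.sum fun x a => m.sum fun y b =>
      (cartan G x.1 y.1 : ℚ) * (min x.2 y.2 : ℕ) * a * b)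
    - m.sum fun x a => (ν x.1 : ℚ) * a

/-- The vacancy number `p_k^{(i)} = ν i - ∑_j (α i, α j) ∑_{l ≥ 1} min(k,l) m_l^{(j)}`. -/
def vacancy (G : SimpleGraph I) [DecidableRel G.Adj] (ν : Weight I) (m : Config I)
    (i : I) (k : ℕ+) : ℤ :=
  ν i - m.sum fun y b => cartan G i y.1 * (min k y.2 : ℕ) * b

/-- The range of the sum in the fermionic form: `p_k^{(i)} ≥ 0` for all `i`, `k`, and
`∑_i ∑_{k ≥ 1} k m_k^{(i)} α i = ν - lam`. -/
def Admissible (G : SimpleGraph I) [DecidableRel G.Adj] (ν lam : Weight I) (m : Config I) : Prop :=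
  (∀ i k, 0 ≤ vacancy G ν m i k) ∧
    (m.sum fun x a => ((x.2 : ℕ) * a) • simpleRoot G x.1) = ν - lam

/-- The fermionic form `M(ν, lam, q)`, for `ν` with `ν_k^{(i)} = 0` for `k ≥ 2`. The sum is finite
for graphs of type ADE; in the product, the factors with `m_k^{(i)} = 0` are omitted as they are
equal to `1`. -/
def fermionicForm (G : SimpleGraph I) [DecidableRel G.Adj] (ν lam : Weight I) : QRing :=
  ∑ᶠ (m : Config I) (_ : Admissible G ν lam m),
    qPow (charge G ν m) *
      m.prod fun x a => Polynomial.aeval (qPow 1) (gaussBinom (vacancy G ν m x.1 x.2).toNat a)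

/-- `∑_{lam ∈ P⁺} (ξ : V_lam) q^{(ν,ν)/2 - (ξ,ξ)/2} M(ν, lam, q)`. -/
def characterSum (G : SimpleGraph I) [DecidableRel G.Adj] (ν ξ : Weight I) : QRing :=
  ∑ᶠ (lam : Weight I) (_ : IsDominant lam),
    weightMult G ξ lam • (qPow (form G ν ν / 2 - form G ξ ξ / 2) * fermionicForm G ν lam)

end Fermionic

end FermionicForm

end

/-!
Write `p_k` for the weight with coordinates `p_k^{(i)}`, and `β_j = ∑_{k > j} ∑_i m_k^{(i)} α i`, so
that `p_k = ν - β_0 - ⋯ - β_{k-1}`; a family `m` contributes to `M(ν, lam, q)` when all `p_k`,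
`k ≥ 1`, are dominant and the sequence ends at `lam`. Expanding the squared lengths gives
`(ν, ν) / 2 - (lam, lam) / 2 + c({m}) = ∑_{j ≥ 1} (p_j, β_j)` (`charge_add_eq`). This is a
nonnegative integer. If it vanishes then `(p_j, β_j) = 0` and `(p_{j+1}, β_j) = -(β_j, β_j)` for
`j ≥ 1`, and the latter is nonnegative because `p_{j+1}` is dominant, so that `m_k^{(i)} = 0` for
`k ≥ 2` (`exists_exponent`); exactly one such `m` is admissible, for each dominant `lam ≤ ν`. The
degree of the product of Gaussian binomial coefficients, added to `c({m})`, is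
`-(1/2) ∑_j (β_j, β_j) ≤ 0`, with value `0` at `m = 0` (`charge_add_sum_vacancy_nonpos`).

On the other hand, if `ξ` is a weight of `V_lam` then `(lam, lam) / 2 - (ξ, ξ) / 2` is a nonnegative
integer, zero only if `ξ` is conjugate to `lam`, in which case the multiplicity is one. Together
with `(ξ : V_lam) ≥ 0` this proves everything: all exponents of `q` in `R_ξ` are natural numbers,
only the dominant conjugate `lam` of `ξ` and the single family `m` above contribute to the constant
term, the degree is at most `(ν, ν) / 2 - (ξ, ξ) / 2`, and `lam = ν`, `m = 0` contributes
`(ξ : V_ν)` in that degree.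

What remains is that weight multiplicities, which are defined by Weyl's formula, are nonnegative,
and positive for dominant weights `≤ lam`. The roots are the elements of squared length `2` in the
root lattice. Dominant representatives of orbits are obtained by applying `s i` to weights with a
negative coordinate `i`; this process is confluent, so the representative is unique
(`domRep`). The element `V_lam` is constructed by induction from orbit sums (`exists_character`),
the denominator is identified with a product over positive roots (`alternant_rho`), and the
Laplacian of the group ring, applied to Weyl's formula, gives Freudenthal's recursion
(`freudenthal`), in which all terms are nonnegative at dominant weights (`weightMult_pos`).
-/

noncomputable section

namespace FermionicForm

open Matrix hiding single

set_option linter.unusedSectionVars false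

variable {I : Type*} [Fintype I] [DecidableEq I]

/-! ### The root lattice -/

section Lattice

variable (G : SimpleGraph I) [DecidableRel G.Adj]

/-- The element `∑ i, n i • α i` of the root lattice, as a weight. -/
def rootVec (n : I → ℤ) : Weight I := cartan G *ᵥ n

theorem cartan_symm (i j : I) : cartan G i j = cartan G j i := by
  simp [cartan, eq_comm, G.adj_comm]

theorem cartan_transpose : (cartan G)ᵀ = cartan G := by
  ext i j; exact cartan_symm G j i

theorem cartan_self (i : I) : cartan G i i = 2 := by simp [cartan]

theorem cartan_nonpos {i j : I} (h : i ≠ j) : cartan G i j ≤ 0 := by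
  simp only [cartan, of_apply, if_neg h]; split_ifs <;> norm_num

theorem simpleRoot_apply (i j : I) : simpleRoot G i j = cartan G i j := rfl

theorem rootVec_apply (n : I → ℤ) (i : I) : rootVec G n i = ∑ j, cartan G i j * n j := rfl

theorem rootVec_add (m n : I → ℤ) : rootVec G (m + n) = rootVec G m + rootVec G n :=
  mulVec_add _ _ _

theorem rootVec_sub (m n : I → ℤ) : rootVec G (m - n) = rootVec G m - rootVec G n :=
  mulVec_sub _ _ _

theorem rootVec_neg (n : I → ℤ) : rootVec G (-n) = -rootVec G n :=
  mulVec_neg _ _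

theorem rootVec_zero : rootVec G 0 = 0 := mulVec_zero _

theorem rootVec_smul (c : ℤ) (n : I → ℤ) : rootVec G (c • n) = c • rootVec G n :=
  mulVec_smul _ _ _

theorem rootVec_sum {κ : Type*} (s : Finset κ) (f : κ → I → ℤ) :
    rootVec G (∑ k ∈ s, f k) = ∑ k ∈ s, rootVec G (f k) :=
  map_sum (mulVecLin (cartan G)) f s

theorem rootVec_single (i : I) : rootVec G (Pi.single i 1) = simpleRoot G i := by
  ext j; simp [rootVec, simpleRoot, cartan_symm G j i]

theorem rootVec_eq_sum (n : I → ℤ) : rootVec G n = ∑ i, n i • simpleRoot G i := by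
  ext j
  simp [rootVec_apply, simpleRoot, cartan_symm G j, mul_comm]

theorem rootVec_dotProduct_comm (m n : I → ℤ) : rootVec G m ⬝ᵥ n = rootVec G n ⬝ᵥ m := by
  rw [rootVec, rootVec, dotProduct_comm, dotProduct_mulVec, ← mulVec_transpose, cartan_transpose]

theorem weightLE_iff {ξ η : Weight I} :
    WeightLE G ξ η ↔ ∃ n : I → ℤ, 0 ≤ n ∧ η = ξ + rootVec G n := by
  constructor
  · rintro ⟨n, hn⟩
    refine ⟨fun i => n i, fun i => Int.natCast_nonneg _, ?_⟩
    rw [rootVec_eq_sum, ← sub_eq_iff_eq_add', hn]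
    simp
  · rintro ⟨n, h0, hn⟩
    refine ⟨fun i => (n i).toNat, ?_⟩
    rw [hn, rootVec_eq_sum, add_sub_cancel_left]
    refine Finset.sum_congr rfl fun i _ => ?_
    rw [← natCast_zsmul, Int.toNat_of_nonneg (h0 i)]

theorem weightLE_refl (ξ : Weight I) : WeightLE G ξ ξ :=
  (weightLE_iff G).2 ⟨0, le_rfl, by simp [rootVec_zero]⟩

variable {G} in
theorem WeightLE.trans {ξ η ζ : Weight I} (h₁ : WeightLE G ξ η) (h₂ : WeightLE G η ζ) :
    WeightLE G ξ ζ := by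
  obtain ⟨m, hm, rfl⟩ := (weightLE_iff G).1 h₁
  obtain ⟨n, hn, rfl⟩ := (weightLE_iff G).1 h₂
  exact (weightLE_iff G).2 ⟨m + n, add_nonneg hm hn, by rw [rootVec_add, add_assoc]⟩

theorem rootVec_dotProduct_self_even (n : I → ℤ) : Even (rootVec G n ⬝ᵥ n) := by
  rw [← ZMod.intCast_eq_zero_iff_even]
  have h : ((rootVec G n ⬝ᵥ n : ℤ) : ZMod 2) =
      ∑ p ∈ (Finset.univ : Finset (I × I)),
        (cartan G p.1 p.2 : ZMod 2) * n p.2 * n p.1 := by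
    rw [← Finset.univ_product_univ, Finset.sum_product]
    simp [dotProduct, rootVec_apply, Finset.sum_mul]
  rw [h]
  refine Finset.sum_involution (fun p _ => p.swap) ?_ ?_ (fun _ _ => Finset.mem_univ _)
    (fun _ _ => rfl)
  · rintro ⟨i, j⟩ -
    have h2 : (2 : ZMod 2) = 0 := rfl
    simp only [Prod.fst_swap, Prod.snd_swap, cartan_symm G j i]
    linear_combination (cartan G i j : ZMod 2) * n j * n i * h2
  · rintro ⟨i, j⟩ - hne heq
    obtain rfl : j = i := congrArg Prod.fst heq
    apply hne
    have h2 : (2 : ZMod 2) = 0 := rfl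
    simp [cartan_self, h2]

/-! ### The form on the weight lattice -/

theorem form_eq_dotProduct (ξ η : Weight I) :
    form G ξ η = (fun i => (ξ i : ℚ)) ⬝ᵥ
      (((cartan G).map (Int.cast : ℤ → ℚ))⁻¹ *ᵥ fun i => (η i : ℚ)) := by
  simp [form, dotProduct, mulVec, Finset.mul_sum, mul_assoc]

theorem form_comm (ξ η : Weight I) : form G ξ η = form G η ξ := by
  have h : (((cartan G).map (Int.cast : ℤ → ℚ))⁻¹)ᵀ = ((cartan G).map (Int.cast : ℤ → ℚ))⁻¹ := by
    rw [transpose_nonsing_inv, ← transpose_map, cartan_transpose]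
  rw [form_eq_dotProduct, form_eq_dotProduct, dotProduct_mulVec, dotProduct_comm,
    ← mulVec_transpose, h]

theorem form_add_right (ξ η ζ : Weight I) : form G ξ (η + ζ) = form G ξ η + form G ξ ζ := by
  simp [form, mul_add, Finset.sum_add_distrib]

theorem form_add_left (ξ η ζ : Weight I) : form G (ξ + η) ζ = form G ξ ζ + form G η ζ := by
  simp [form, add_mul, Finset.sum_add_distrib]

theorem form_smul_right (c : ℤ) (ξ η : Weight I) : form G ξ (c • η) = c * form G ξ η := by
  simp [form, Finset.mul_sum, mul_left_comm]

theorem form_smul_left (c : ℤ) (ξ η : Weight I) : form G (c • ξ) η = c * form G ξ η := by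
  rw [form_comm, form_smul_right, form_comm]

theorem form_neg_right (ξ η : Weight I) : form G ξ (-η) = -form G ξ η := by
  simp [form]

theorem form_neg_left (ξ η : Weight I) : form G (-ξ) η = -form G ξ η := by
  simp [form]

theorem form_sub_right (ξ η ζ : Weight I) : form G ξ (η - ζ) = form G ξ η - form G ξ ζ := by
  rw [sub_eq_add_neg, form_add_right, form_neg_right, sub_eq_add_neg]

theorem form_sub_left (ξ η ζ : Weight I) : form G (ξ - η) ζ = form G ξ ζ - form G η ζ := by
  rw [sub_eq_add_neg, form_add_left, form_neg_left, sub_eq_add_neg]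

variable {G} (hG : IsADE G)
include hG

theorem form_rootVec (ξ : Weight I) (n : I → ℤ) : form G ξ (rootVec G n) = (ξ ⬝ᵥ n : ℤ) := by
  rw [rootVec_eq_sum]
  have : ∀ s : Finset I, form G ξ (∑ i ∈ s, n i • simpleRoot G i) =
      ((∑ i ∈ s, ξ i * n i : ℤ) : ℚ) := by
    intro s
    induction s using Finset.induction_on with
    | empty => simp [form]
    | insert i s hi ih =>
      rw [Finset.sum_insert hi, form_add_right, ih, form_smul_right, form_simpleRoot G hG,
        Finset.sum_insert hi]
      push_cast; ring
  exact this _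

theorem rootVec_dotProduct_self_pos {n : I → ℤ} (hn : n ≠ 0) : 0 < rootVec G n ⬝ᵥ n := by
  have hn' : (fun i => (n i : ℝ)) ≠ 0 := by
    contrapose! hn
    ext i
    simpa using congrFun hn i
  have h := hG.dotProduct_mulVec_pos hn'
  have : ((rootVec G n ⬝ᵥ n : ℤ) : ℝ) = star (fun i => (n i : ℝ)) ⬝ᵥ
      ((cartan G).map (Int.cast : ℤ → ℝ) *ᵥ fun i => (n i : ℝ)) := by
    rw [dotProduct_comm]
    simp [dotProduct, rootVec_apply, mulVec]
  rw [← this] at h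
  exact_mod_cast h

theorem rootVec_dotProduct_self_nonneg (n : I → ℤ) : 0 ≤ rootVec G n ⬝ᵥ n := by
  rcases eq_or_ne n 0 with rfl | h
  · simp
  · exact (rootVec_dotProduct_self_pos hG h).le

theorem rootVec_dotProduct_self_eq_zero {n : I → ℤ} : rootVec G n ⬝ᵥ n = 0 ↔ n = 0 :=
  ⟨fun h => by_contra fun hn => (rootVec_dotProduct_self_pos hG hn).ne' h, by rintro rfl; simp⟩

theorem rootVec_injective : Function.Injective (rootVec G) := by
  intro m n h
  rw [← sub_eq_zero, ← rootVec_dotProduct_self_eq_zero hG, rootVec_sub, h, sub_self,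
    zero_dotProduct]

theorem cartan_det_ne_zero : (cartan G).det ≠ 0 := by
  intro h
  obtain ⟨v, hv, hv'⟩ := exists_mulVec_eq_zero_iff.2 h
  exact hv (rootVec_injective hG (hv'.trans (rootVec_zero G).symm))

/-- A nonzero multiple of every weight lies in the root lattice. -/
theorem exists_smul_eq_rootVec (ξ : Weight I) :
    ∃ (d : ℤ) (n : I → ℤ), d ≠ 0 ∧ d • ξ = rootVec G n :=
  ⟨(cartan G).det, (cartan G).adjugate *ᵥ ξ, cartan_det_ne_zero hG, by
    rw [rootVec, mulVec_mulVec, mul_adjugate, smul_mulVec, one_mulVec]⟩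

theorem form_self_pos {ξ : Weight I} (hξ : ξ ≠ 0) : 0 < form G ξ ξ := by
  obtain ⟨d, n, hd, hn⟩ := exists_smul_eq_rootVec hG ξ
  have hn0 : n ≠ 0 := by
    rintro rfl
    rw [rootVec_zero] at hn
    exact (smul_ne_zero hd hξ) hn
  have h : (d : ℚ) * (d * form G ξ ξ) = (rootVec G n ⬝ᵥ n : ℤ) := by
    rw [← form_smul_right, ← form_smul_left, hn, form_rootVec hG]
  have h1 : (0 : ℚ) < (rootVec G n ⬝ᵥ n : ℤ) := by
    exact_mod_cast rootVec_dotProduct_self_pos hG hn0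
  rw [← h, ← mul_assoc] at h1
  exact pos_of_mul_pos_right h1 (mul_self_nonneg _)

theorem form_self_nonneg (ξ : Weight I) : 0 ≤ form G ξ ξ := by
  rcases eq_or_ne ξ 0 with rfl | h
  · simp [form]
  · exact (form_self_pos hG h).le

theorem form_self_add_rootVec (ξ : Weight I) (n : I → ℤ) :
    form G (ξ + rootVec G n) (ξ + rootVec G n) =
      form G ξ ξ + ((2 * (ξ ⬝ᵥ n) + rootVec G n ⬝ᵥ n : ℤ) : ℚ) := by
  simp only [form_add_left, form_add_right]
  rw [form_comm G (rootVec G n) ξ]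
  simp only [form_rootVec hG]
  push_cast; ring

theorem form_self_sub_rootVec (ξ : Weight I) (n : I → ℤ) :
    form G (ξ - rootVec G n) (ξ - rootVec G n) =
      form G ξ ξ - ((2 * (ξ ⬝ᵥ n) - rootVec G n ⬝ᵥ n : ℤ) : ℚ) := by
  rw [sub_eq_add_neg, ← rootVec_neg, form_self_add_rootVec hG, rootVec_neg]
  simp only [dotProduct_neg, neg_dotProduct]
  push_cast; ring

/-- The Cauchy-Schwarz inequality for `ξ` and `α i`. -/
theorem sq_coord_le (ξ : Weight I) (i : I) : ((ξ i : ℤ) : ℚ) ^ 2 ≤ 2 * form G ξ ξ := by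
  have h := form_self_nonneg hG ((2 : ℤ) • ξ - ξ i • simpleRoot G i)
  simp only [form_sub_left, form_sub_right, form_smul_left, form_smul_right,
    form_comm G (simpleRoot G i) ξ, form_simpleRoot G hG, Pi.sub_apply,
    Pi.smul_apply, smul_eq_mul, simpleRoot_apply, cartan_self] at h
  push_cast at h
  nlinarith

theorem finite_form_self_le (N : ℚ) : {ξ : Weight I | form G ξ ξ ≤ N}.Finite := by
  obtain ⟨b, hb⟩ := exists_nat_gt (2 * N)
  refine (Set.Finite.pi' fun _ : I => Set.finite_Icc (-(b : ℤ)) b).subset fun ξ hξ i => ?_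
  have h1 := sq_coord_le hG ξ i
  have h2 : form G ξ ξ ≤ N := hξ
  have h3 : ((ξ i ^ 2 : ℤ) : ℚ) < ((b : ℤ) : ℚ) := by push_cast; linarith
  have h4 : ξ i ^ 2 < (b : ℤ) := by exact_mod_cast h3
  constructor <;> nlinarith

omit hG in
theorem simpleReflection_apply (i : I) (ξ : Weight I) :
    simpleReflection G i ξ = ξ - ξ i • simpleRoot G i :=
  Module.reflection_apply _ _

omit hG in
theorem simpleReflection_apply_self (i : I) (ξ : Weight I) : simpleReflection G i ξ i = -ξ i := by
  simp [simpleReflection_apply, simpleRoot_apply, cartan_self]; ring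

omit hG in
theorem simpleReflection_involutive (i : I) (ξ : Weight I) :
    simpleReflection G i (simpleReflection G i ξ) = ξ :=
  Module.involutive_reflection _ _

theorem form_simpleReflection (i : I) (ξ η : Weight I) :
    form G (simpleReflection G i ξ) (simpleReflection G i η) = form G ξ η := by
  simp only [simpleReflection_apply, form_sub_left, form_sub_right, form_smul_left,
    form_smul_right, form_comm G (simpleRoot G i) η, form_simpleRoot G hG, Pi.sub_apply,
    Pi.smul_apply, smul_eq_mul, simpleRoot_apply, cartan_self]
  push_cast; ring

theorem form_weylGroup {w : Weight I ≃ₗ[ℤ] Weight I} (hw : w ∈ weylGroup G) (ξ η : Weight I) :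
    form G (w ξ) (w η) = form G ξ η := by
  induction hw using Subgroup.closure_induction generalizing ξ η with
  | mem x hx => obtain ⟨i, rfl⟩ := hx; exact form_simpleReflection hG i ξ η
  | one => rfl
  | mul x y _ _ hx hy => rw [LinearEquiv.mul_apply, LinearEquiv.mul_apply, hx, hy]
  | inv x _ hx =>
    rw [← hx (x⁻¹ ξ) (x⁻¹ η)]
    change form G (x (x.symm ξ)) (x (x.symm η)) = _
    simp

theorem finite_weylGroup : Finite (weylGroup G) := by
  have hfin : ∀ i : I, Finite {ξ : Weight I | form G ξ ξ ≤
      form G (Pi.single i 1) (Pi.single i 1)} := fun i => (finite_form_self_le hG _).to_subtype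
  refine Finite.of_injective (β := ∀ i : I, {ξ : Weight I | form G ξ ξ ≤
      form G (Pi.single i 1) (Pi.single i 1)})
    (fun w i => ⟨w.1 (Pi.single i 1), (form_weylGroup hG w.2 _ _).le⟩) ?_
  intro v w h
  apply Subtype.ext
  refine LinearEquiv.toLinearMap_injective ((Pi.basisFun ℤ I).ext fun i => ?_)
  simpa using congrArg Subtype.val (congrFun h i)

end Lattice

/-! ### Dominant representatives of Weyl group orbits -/

section DominantRep

variable {G : SimpleGraph I} [DecidableRel G.Adj]

theorem simpleReflection_apply_apply (i j : I) (ξ : Weight I) :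
    simpleReflection G i ξ j = ξ j - ξ i * cartan G i j := by
  simp [simpleReflection_apply, simpleRoot_apply]

variable (G) in
/-- An ascent from `ξ`: a simple reflection `s i` applied to a weight with `ξ i < 0`, which adds a
positive multiple of `α i`. -/
def Ascent (ξ η : Weight I) : Prop := ∃ i, ξ i < 0 ∧ η = simpleReflection G i ξ

theorem Ascent.weightLE {ξ η : Weight I} (h : Ascent G ξ η) : WeightLE G ξ η := by
  obtain ⟨i, hi, rfl⟩ := h
  refine (weightLE_iff G).2 ⟨(-ξ i) • Pi.single i 1, ?_, ?_⟩
  · exact smul_nonneg (by omega) (Pi.single_nonneg.2 zero_le_one)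
  · rw [rootVec_smul, rootVec_single, simpleReflection_apply, neg_smul, sub_eq_add_neg]

theorem not_ascent_of_isDominant {ξ η : Weight I} (h : IsDominant ξ) : ¬ Ascent G ξ η := by
  rintro ⟨i, hi, -⟩
  exact absurd (h i) (not_le.2 hi)

theorem eq_of_reflTransGen_ascent {ξ η : Weight I} (h : IsDominant ξ)
    (h' : Relation.ReflTransGen (Ascent G) ξ η) : η = ξ := by
  rcases Relation.ReflTransGen.cases_head h' with h1 | ⟨ζ, h1, -⟩
  · exact h1.symm
  · exact absurd h1 (not_ascent_of_isDominant h)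

/-- Ascents are locally confluent: this is the defining relation of the dihedral group generated by
two simple reflections. -/
theorem ascent_locally_confluent {ξ η ζ : Weight I} (h₁ : Ascent G ξ η) (h₂ : Ascent G ξ ζ) :
    ∃ θ, Relation.ReflTransGen (Ascent G) η θ ∧ Relation.ReflTransGen (Ascent G) ζ θ := by
  obtain ⟨i, hi, rfl⟩ := h₁
  obtain ⟨j, hj, rfl⟩ := h₂
  rcases eq_or_ne i j with rfl | hij
  · exact ⟨_, .refl, .refl⟩
  have hsymm := cartan_symm G i j
  by_cases hadj : G.Adj i j
  · have hc : cartan G i j = -1 := by simp [cartan, hij, hadj]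
    have hc' : cartan G j i = -1 := hsymm ▸ hc
    refine ⟨simpleReflection G i (simpleReflection G j (simpleReflection G i ξ)), ?_, ?_⟩
    · refine (Relation.ReflTransGen.single ⟨j, ?_, rfl⟩).tail ⟨i, ?_, rfl⟩ <;>
      · simp only [simpleReflection_apply_apply, hc, hc', cartan_self]; linarith
    · have heq : simpleReflection G i (simpleReflection G j (simpleReflection G i ξ)) =
          simpleReflection G j (simpleReflection G i (simpleReflection G j ξ)) := by
        ext k
        simp only [simpleReflection_apply_apply, hc, hc', cartan_self]; ring
      rw [heq]
      refine (Relation.ReflTransGen.single ⟨i, ?_, rfl⟩).tail ⟨j, ?_, rfl⟩ <;>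
      · simp only [simpleReflection_apply_apply, hc, hc', cartan_self]; linarith
  · have hc : cartan G i j = 0 := by simp [cartan, hij, hadj]
    have hc' : cartan G j i = 0 := hsymm ▸ hc
    refine ⟨simpleReflection G j (simpleReflection G i ξ), ?_, ?_⟩
    · refine .single ⟨j, ?_, rfl⟩
      simp only [simpleReflection_apply_apply, hc]; linarith
    · refine .single ⟨i, ?_, ?_⟩
      · simp only [simpleReflection_apply_apply, hc']; linarith
      · ext k
        simp only [simpleReflection_apply_apply, hc, hc']; ring

theorem floor_lt_floor_of_add_one_le {a b : ℚ} (ha : 0 ≤ a) (h : a + 1 ≤ b) :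
    ⌊a⌋₊ < ⌊b⌋₊ := by
  refine Nat.le_floor ?_
  have := Nat.floor_le ha
  push_cast
  linarith

variable (hG : IsADE G)
include hG

theorem form_simpleReflection_sub_rho (ξ : Weight I) (i : I) :
    form G (simpleReflection G i ξ - rho) (simpleReflection G i ξ - rho) =
      form G (ξ - rho) (ξ - rho) + 2 * ξ i := by
  have h : simpleReflection G i ξ - rho = ξ - rho - rootVec G (ξ i • Pi.single i 1) := by
    rw [rootVec_smul, rootVec_single, simpleReflection_apply]; abel
  have h1 : (ξ - rho) ⬝ᵥ (ξ i • Pi.single i (1 : ℤ)) = ξ i * (ξ i - 1) := by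
    rw [dotProduct_smul, dotProduct_single_one, smul_eq_mul]; rfl
  have h2 : rootVec G (ξ i • Pi.single i 1) ⬝ᵥ (ξ i • Pi.single i (1 : ℤ)) = 2 * ξ i ^ 2 := by
    rw [dotProduct_smul, dotProduct_single_one, rootVec_smul, rootVec_single, smul_eq_mul,
      Pi.smul_apply, simpleRoot_apply, cartan_self, smul_eq_mul]
    ring
  rw [h, form_self_sub_rootVec hG, h1, h2]
  push_cast
  ring

/-- Induction along ascents, which terminate because each of them lowers the squared distance to
`ρ` by at least `2`. -/
theorem ascent_induction {p : Weight I → Prop}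
    (h : ∀ ξ, (∀ i, ξ i < 0 → p (simpleReflection G i ξ)) → p ξ) (ξ : Weight I) : p ξ := by
  induction hn : ⌊form G (ξ - rho) (ξ - rho)⌋₊ using Nat.strong_induction_on generalizing ξ with
  | _ n ih =>
    subst hn
    refine h ξ fun i hi => ih _ ?_ _ rfl
    refine floor_lt_floor_of_add_one_le (form_self_nonneg hG _) ?_
    rw [form_simpleReflection_sub_rho hG]
    have : ((ξ i : ℤ) : ℚ) ≤ -1 := by exact_mod_cast Int.le_sub_one_of_lt hi
    linarith

theorem exists_reflTransGen_ascent (ξ : Weight I) :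
    ∃ η, IsDominant η ∧ Relation.ReflTransGen (Ascent G) ξ η := by
  induction ξ using ascent_induction hG with
  | h ξ ih =>
    by_cases hd : IsDominant ξ
    · exact ⟨ξ, hd, .refl⟩
    · obtain ⟨i, hi⟩ := not_forall.1 hd
      obtain ⟨η, h1, h2⟩ := ih i (not_le.1 hi)
      exact ⟨η, h1, h2.head ⟨i, not_le.1 hi, rfl⟩⟩

/-- Newman's lemma for ascents. -/
theorem reflTransGen_ascent_unique (ξ : Weight I) : ∀ {η ζ : Weight I}, IsDominant η →
    IsDominant ζ → Relation.ReflTransGen (Ascent G) ξ η →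
    Relation.ReflTransGen (Ascent G) ξ ζ → η = ζ := by
  induction ξ using ascent_induction hG with
  | h ξ ih =>
    intro η ζ hη hζ h1 h2
    rcases Relation.ReflTransGen.cases_head h1 with rfl | ⟨η', ha, h1'⟩
    · exact (eq_of_reflTransGen_ascent hη h2).symm
    rcases Relation.ReflTransGen.cases_head h2 with rfl | ⟨ζ', hb, h2'⟩
    · exact eq_of_reflTransGen_ascent hζ h1
    obtain ⟨θ, h3, h4⟩ := ascent_locally_confluent ha hb
    obtain ⟨κ, hκ, h5⟩ := exists_reflTransGen_ascent hG θ
    obtain ⟨i, hi, rfl⟩ := ha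
    obtain ⟨j, hj, rfl⟩ := hb
    rw [ih i hi hη hκ h1' (h3.trans h5), ih j hj hζ hκ h2' (h4.trans h5)]

/-- The dominant weight in the Weyl group orbit of `ξ`, defined as the weight at which ascents
from `ξ` end. -/
def domRep (ξ : Weight I) : Weight I := (exists_reflTransGen_ascent hG ξ).choose

theorem isDominant_domRep (ξ : Weight I) : IsDominant (domRep hG ξ) :=
  (exists_reflTransGen_ascent hG ξ).choose_spec.1

theorem reflTransGen_domRep (ξ : Weight I) :
    Relation.ReflTransGen (Ascent G) ξ (domRep hG ξ) :=
  (exists_reflTransGen_ascent hG ξ).choose_spec.2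

theorem domRep_of_isDominant {ξ : Weight I} (h : IsDominant ξ) : domRep hG ξ = ξ :=
  eq_of_reflTransGen_ascent h (reflTransGen_domRep hG ξ)

theorem weightLE_domRep (ξ : Weight I) : WeightLE G ξ (domRep hG ξ) := by
  have h := reflTransGen_domRep hG ξ
  generalize domRep hG ξ = η at h ⊢
  induction h with
  | refl => exact weightLE_refl G ξ
  | tail _ h ih => exact ih.trans h.weightLE

theorem Ascent.domRep_eq {ξ η : Weight I} (h : Ascent G ξ η) : domRep hG η = domRep hG ξ :=
  reflTransGen_ascent_unique hG ξ (isDominant_domRep hG _) (isDominant_domRep hG _)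
    ((reflTransGen_domRep hG η).head h) (reflTransGen_domRep hG ξ)

theorem domRep_simpleReflection (i : I) (ξ : Weight I) :
    domRep hG (simpleReflection G i ξ) = domRep hG ξ := by
  rcases lt_trichotomy (ξ i) 0 with h | h | h
  · exact Ascent.domRep_eq hG ⟨i, h, rfl⟩
  · rw [simpleReflection_apply, h, zero_smul, sub_zero]
  · refine (Ascent.domRep_eq hG ⟨i, ?_, (simpleReflection_involutive i ξ).symm⟩).symm
    rw [simpleReflection_apply_self]; omega

theorem domRep_weylGroup {w : Weight I ≃ₗ[ℤ] Weight I} (hw : w ∈ weylGroup G) (ξ : Weight I) :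
    domRep hG (w ξ) = domRep hG ξ := by
  induction hw using Subgroup.closure_induction generalizing ξ with
  | mem x hx => obtain ⟨i, rfl⟩ := hx; exact domRep_simpleReflection hG i ξ
  | one => rfl
  | mul x y _ _ hx hy => rw [LinearEquiv.mul_apply, hx, hy]
  | inv x _ hx =>
    rw [← hx (x⁻¹ ξ)]
    change domRep hG (x (x.symm ξ)) = _
    simp

omit hG in
theorem simpleReflection_mem_weylGroup (i : I) : simpleReflection G i ∈ weylGroup G :=
  Subgroup.subset_closure ⟨i, rfl⟩

theorem exists_weylGroup_apply_eq_domRep (ξ : Weight I) :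
    ∃ w ∈ weylGroup G, w ξ = domRep hG ξ := by
  have h := reflTransGen_domRep hG ξ
  generalize domRep hG ξ = η at h ⊢
  induction h with
  | refl => exact ⟨1, one_mem _, rfl⟩
  | tail _ h ih =>
    obtain ⟨w, hw, hw'⟩ := ih
    obtain ⟨i, -, rfl⟩ := h
    exact ⟨simpleReflection G i * w, mul_mem (simpleReflection_mem_weylGroup i) hw, by
      rw [LinearEquiv.mul_apply, hw']⟩

theorem form_domRep (ξ : Weight I) : form G (domRep hG ξ) (domRep hG ξ) = form G ξ ξ := by
  obtain ⟨w, hw, h⟩ := exists_weylGroup_apply_eq_domRep hG ξ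
  rw [← h, form_weylGroup hG hw]

theorem weylGroup_apply_weightLE {ξ : Weight I} (h : IsDominant ξ)
    {w : Weight I ≃ₗ[ℤ] Weight I} (hw : w ∈ weylGroup G) : WeightLE G (w ξ) ξ := by
  have := weightLE_domRep hG (w ξ)
  rwa [domRep_weylGroup hG hw, domRep_of_isDominant hG h] at this

end DominantRep

/-! ### Positive roots -/

section Roots

variable {G : SimpleGraph I} [DecidableRel G.Adj]

/-- `(ξ, β) ≥ 0` for `ξ` dominant and `β` a combination of simple roots with coefficients in `ℕ`. -/
theorem IsDominant.dotProduct_nonneg {ξ : Weight I} (h : IsDominant ξ) {n : I → ℤ} (hn : 0 ≤ n) :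
    0 ≤ ξ ⬝ᵥ n :=
  Finset.sum_nonneg fun i _ => mul_nonneg (h i) (hn i)

theorem rootVec_apply_nonpos {n : I → ℤ} (hn : 0 ≤ n) {i : I} (hi : n i = 0) :
    rootVec G n i ≤ 0 := by
  rw [rootVec_apply]
  refine Finset.sum_nonpos fun j _ => ?_
  rcases eq_or_ne i j with rfl | hij
  · simp [hi]
  · exact mul_nonpos_of_nonpos_of_nonneg (cartan_nonpos G hij) (hn j)

variable (G) in
/-- The element `∑ i, n i • α i` of the root lattice is a positive root. In a simply laced root
lattice the roots are the elements of squared length `2`. -/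
def IsPosRoot (n : I → ℤ) : Prop := 0 ≤ n ∧ rootVec G n ⬝ᵥ n = 2

theorem rootVec_single_dotProduct (i : I) (n : I → ℤ) :
    rootVec G (Pi.single i 1) ⬝ᵥ n = rootVec G n i := by
  rw [rootVec_dotProduct_comm]; simp

theorem isPosRoot_single (i : I) : IsPosRoot G (Pi.single i 1) :=
  ⟨Pi.single_nonneg.2 zero_le_one, by
    rw [rootVec_single_dotProduct, rootVec_single, simpleRoot_apply, cartan_self]⟩

theorem rootVec_add_single_dotProduct_self (n : I → ℤ) (i : I) (c : ℤ) :
    rootVec G (n + c • Pi.single i 1) ⬝ᵥ (n + c • Pi.single i 1) =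
      rootVec G n ⬝ᵥ n + 2 * c * rootVec G n i + 2 * c ^ 2 := by
  simp only [rootVec_add, rootVec_smul, add_dotProduct, dotProduct_add, smul_dotProduct,
    dotProduct_smul, rootVec_single_dotProduct, smul_eq_mul]
  simp [rootVec_single, simpleRoot_apply, cartan_self]
  ring

/-- The action of `s i` on the root lattice. -/
def reflectRoot (G : SimpleGraph I) [DecidableRel G.Adj] (i : I) (n : I → ℤ) : I → ℤ :=
  n + (-rootVec G n i) • Pi.single i 1

theorem rootVec_reflectRoot (i : I) (n : I → ℤ) :
    rootVec G (reflectRoot G i n) = simpleReflection G i (rootVec G n) := by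
  rw [reflectRoot, rootVec_add, rootVec_smul, rootVec_single, simpleReflection_apply, neg_smul,
    sub_eq_add_neg]

theorem reflectRoot_apply_of_ne {i j : I} (h : j ≠ i) (n : I → ℤ) :
    reflectRoot G i n j = n j := by
  simp [reflectRoot, h]

theorem reflectRoot_dotProduct_self (i : I) (n : I → ℤ) :
    rootVec G (reflectRoot G i n) ⬝ᵥ reflectRoot G i n = rootVec G n ⬝ᵥ n := by
  rw [reflectRoot, rootVec_add_single_dotProduct_self]; ring

theorem reflectRoot_involutive (i : I) (n : I → ℤ) :
    reflectRoot G i (reflectRoot G i n) = n := by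
  have : rootVec G (reflectRoot G i n) i = - rootVec G n i := by
    rw [rootVec_reflectRoot, simpleReflection_apply_self]
  rw [reflectRoot, this, reflectRoot, neg_neg, add_assoc, ← add_smul, neg_add_cancel, zero_smul,
    add_zero]

variable (hG : IsADE G)
include hG

theorem exists_weylGroup_apply_rootVec {w : Weight I ≃ₗ[ℤ] Weight I} (hw : w ∈ weylGroup G)
    (n : I → ℤ) : ∃ m, w (rootVec G n) = rootVec G m ∧ rootVec G m ⬝ᵥ m = rootVec G n ⬝ᵥ n := by
  have h : (∀ n, ∃ m, w (rootVec G n) = rootVec G m) ∧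
      ∀ n, ∃ m, w⁻¹ (rootVec G n) = rootVec G m := by
    induction hw using Subgroup.closure_induction with
    | mem x hx =>
      obtain ⟨i, rfl⟩ := hx
      exact ⟨fun n => ⟨_, (rootVec_reflectRoot i n).symm⟩,
        fun n => ⟨_, (rootVec_reflectRoot i n).symm⟩⟩
    | one => exact ⟨fun n => ⟨n, rfl⟩, fun n => ⟨n, rfl⟩⟩
    | mul x y _ _ hx hy =>
      refine ⟨fun n => ?_, fun n => ?_⟩
      · obtain ⟨m, hm⟩ := hy.1 n
        obtain ⟨k, hk⟩ := hx.1 m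
        exact ⟨k, by rw [LinearEquiv.mul_apply, hm, hk]⟩
      · obtain ⟨m, hm⟩ := hx.2 n
        obtain ⟨k, hk⟩ := hy.2 m
        exact ⟨k, by rw [_root_.mul_inv_rev, LinearEquiv.mul_apply, hm, hk]⟩
    | inv x _ hx => exact ⟨hx.2, by rw [inv_inv]; exact hx.1⟩
  obtain ⟨m, hm⟩ := h.1 n
  refine ⟨m, hm, ?_⟩
  have := form_weylGroup hG hw (rootVec G n) (rootVec G n)
  rw [hm, form_rootVec hG, form_rootVec hG] at this
  exact_mod_cast this

/-- Every root is positive or negative: writing it as `β - γ` with `β`, `γ` nonnegative with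
disjoint supports, `(β, γ) ≤ 0`, so that `β` and `γ`, whose squared lengths are even, are not both
nonzero. -/
theorem nonneg_or_nonpos_of_dotProduct_self_eq_two {n : I → ℤ} (hn : rootVec G n ⬝ᵥ n = 2) :
    0 ≤ n ∨ n ≤ 0 := by
  set p : I → ℤ := fun i => max (n i) 0 with hp
  set q : I → ℤ := fun i => max (-n i) 0 with hq
  have hnpq : n = p - q := by
    ext i; simp only [hp, hq, Pi.sub_apply]; omega
  have hpq : rootVec G p ⬝ᵥ q ≤ 0 := by
    refine Finset.sum_nonpos fun i _ => ?_
    rcases le_total (n i) 0 with h | h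
    · refine mul_nonpos_of_nonpos_of_nonneg (rootVec_apply_nonpos (fun j => le_max_right _ _) ?_)
        (le_max_right _ _)
      simpa [hp] using h
    · have : q i = 0 := by simpa [hq] using h
      simp [this]
  have hsum : rootVec G p ⬝ᵥ p + rootVec G q ⬝ᵥ q - 2 * (rootVec G p ⬝ᵥ q) = 2 := by
    conv_rhs => rw [← hn, hnpq, rootVec_sub]
    simp only [sub_dotProduct, dotProduct_sub, rootVec_dotProduct_comm G q p]
    ring
  by_contra! hcon
  have hp0 : p ≠ 0 := by
    intro h0
    refine hcon.2 fun i => ?_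
    have := congrFun h0 i
    simp only [hp, Pi.zero_apply] at this ⊢
    omega
  have hq0 : q ≠ 0 := by
    intro h0
    refine hcon.1 fun i => ?_
    have := congrFun h0 i
    simp only [hq, Pi.zero_apply] at this ⊢
    omega
  have h1 := rootVec_dotProduct_self_pos hG hp0
  have h2 := rootVec_dotProduct_self_pos hG hq0
  obtain ⟨a, ha⟩ := rootVec_dotProduct_self_even G p
  obtain ⟨b, hb⟩ := rootVec_dotProduct_self_even G q
  omega

/-- A simple reflection permutes the positive roots other than its own. -/
theorem IsPosRoot.reflectRoot {n : I → ℤ} (h : IsPosRoot G n) {i : I}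
    (hi : n ≠ Pi.single i 1) : IsPosRoot G (reflectRoot G i n) := by
  have h2 := (reflectRoot_dotProduct_self i n).trans h.2
  refine ⟨(nonneg_or_nonpos_of_dotProduct_self_eq_two hG h2).resolve_right fun hle => hi ?_, h2⟩
  have hz : ∀ j ≠ i, n j = 0 := fun j hj =>
    le_antisymm (by simpa [reflectRoot_apply_of_ne hj] using hle j) (h.1 j)
  have hn : n = n i • Pi.single i 1 := by
    ext j
    rcases eq_or_ne j i with rfl | hj
    · simp
    · simp [hz j hj, hj]
  have hsq := h.2
  have hz := rootVec_add_single_dotProduct_self (G := G) 0 i (n i)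
  rw [zero_add, ← hn, hsq, rootVec_zero] at hz
  simp only [zero_dotProduct, Pi.zero_apply, mul_zero, zero_add] at hz
  have h0 : (0 : ℤ) ≤ n i := h.1 i
  have h1 : n i = 1 := by nlinarith
  rw [hn, h1, one_smul]

theorem finite_isPosRoot : {n : I → ℤ | IsPosRoot G n}.Finite := by
  refine Set.Finite.of_finite_image (f := rootVec G) ?_ (rootVec_injective hG).injOn
  refine (finite_form_self_le hG 2).subset ?_
  rintro _ ⟨n, hn, rfl⟩
  simp [form_rootVec hG, hn.2]

/-- The set of positive roots. -/
def posRoots : Finset (I → ℤ) := (finite_isPosRoot hG).toFinset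

theorem mem_posRoots {n : I → ℤ} : n ∈ posRoots hG ↔ IsPosRoot G n := by simp [posRoots]

omit hG in
theorem IsPosRoot.ne_zero {n : I → ℤ} (h : IsPosRoot G n) : n ≠ 0 := by
  rintro rfl
  simpa [rootVec_zero] using h.2

/-- Every positive root is obtained from a simple one by simple reflections, each of which increases
the height. -/
theorem posRoot_induction {p : (I → ℤ) → Prop} (simple : ∀ i, p (Pi.single i 1))
    (step : ∀ n i, IsPosRoot G n → p (reflectRoot G i n) → p n) {n : I → ℤ}
    (hn : IsPosRoot G n) : p n := by
  induction hk : (∑ i, n i).toNat using Nat.strong_induction_on generalizing n with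
  | _ k ih =>
    subst hk
    obtain ⟨i, hi⟩ : ∃ i, 0 < rootVec G n i := by
      by_contra! hcon
      have : rootVec G n ⬝ᵥ n ≤ 0 :=
        Finset.sum_nonpos fun i _ => mul_nonpos_of_nonpos_of_nonneg (hcon i) (hn.1 i)
      have := hn.2
      omega
    by_cases hs : n = Pi.single i 1
    · rw [hs]; exact simple i
    have hr := hn.reflectRoot hG hs
    refine step n i hn (ih _ ?_ hr rfl)
    have h1 : ∑ j, FermionicForm.reflectRoot G i n j = ∑ j, n j - rootVec G n i := by
      simp [FermionicForm.reflectRoot, Finset.sum_add_distrib, sub_eq_add_neg, ← Finset.mul_sum]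
    have h2 : 0 ≤ ∑ j, FermionicForm.reflectRoot G i n j := Finset.sum_nonneg fun j _ => hr.1 j
    omega

/-- The Weyl group acts freely on strictly dominant weights. -/
theorem eq_one_of_weylGroup_apply_eq {w : Weight I ≃ₗ[ℤ] Weight I} (hw : w ∈ weylGroup G)
    {μ : Weight I} (hμ : ∀ i, 0 < μ i) (h : w μ = μ) : w = 1 := by
  -- `w⁻¹ (α j)` is a root that pairs positively with `μ`, so it is positive; hence `w` preserves
  -- dominance, and so it fixes every dominant weight.
  have hdom : ∀ ξ : Weight I, IsDominant ξ → w ξ = ξ := by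
    intro ξ hξ
    have : IsDominant (w ξ) := by
      intro j
      obtain ⟨m, hm, hm2⟩ := exists_weylGroup_apply_rootVec hG (inv_mem hw) (Pi.single j 1)
      rw [(isPosRoot_single j).2] at hm2
      have hpair : ∀ η : Weight I, w η j = η ⬝ᵥ m := by
        intro η
        have h1 := form_weylGroup hG hw η (rootVec G m)
        have h2 : w (rootVec G m) = simpleRoot G j := by
          rw [← hm, ← LinearEquiv.mul_apply, mul_inv_cancel, rootVec_single]; rfl
        rw [h2, form_simpleRoot G hG, form_rootVec hG] at h1
        exact_mod_cast h1
      rw [hpair]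
      refine hξ.dotProduct_nonneg
        ((nonneg_or_nonpos_of_dotProduct_self_eq_two hG hm2).resolve_right fun hle => ?_)
      have h3 := hpair μ
      rw [h] at h3
      have h4 : μ ⬝ᵥ m ≤ 0 :=
        Finset.sum_nonpos fun i _ => mul_nonpos_of_nonneg_of_nonpos (hμ i).le (hle i)
      have := hμ j
      omega
    rw [← domRep_of_isDominant hG this, domRep_weylGroup hG hw, domRep_of_isDominant hG hξ]
  refine LinearEquiv.toLinearMap_injective ((Pi.basisFun ℤ I).ext fun i => ?_)
  have hd : IsDominant (Pi.single i 1 : Weight I) :=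
    (Pi.single_nonneg.2 zero_le_one : (0 : I → ℤ) ≤ Pi.single i 1)
  simpa using hdom _ hd

/-- If `μ < μ + β` are dominant then `μ + γ` is dominant for some positive root `γ ≤ β`: any maximal
`γ` will do. -/
theorem exists_isPosRoot_isDominant_add {μ : Weight I} {b : I → ℤ} (hμ : IsDominant μ)
    (hb : 0 ≤ b) (hb0 : b ≠ 0) (hdom : IsDominant (μ + rootVec G b)) :
    ∃ n, IsPosRoot G n ∧ n ≤ b ∧ IsDominant (μ + rootVec G n) := by
  have hfin : {n | IsPosRoot G n ∧ n ≤ b}.Finite :=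
    (finite_isPosRoot hG).subset fun n hn => hn.1
  have hne : {n | IsPosRoot G n ∧ n ≤ b}.Nonempty := by
    obtain ⟨i, hi⟩ := Function.ne_iff.1 hb0
    refine ⟨Pi.single i 1, isPosRoot_single i, fun j => ?_⟩
    have hbi : (0 : ℤ) ≤ b i := hb i
    rcases eq_or_ne j i with rfl | hj
    · simp only [Pi.single_eq_same, Pi.zero_apply] at hi ⊢; omega
    · simpa [hj] using hb j
  obtain ⟨n, ⟨hn, hnb⟩, hmax⟩ := hfin.exists_maximalFor (fun n => ∑ i, n i) _ hne
  refine ⟨n, hn, hnb, fun j => ?_⟩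
  by_contra! hj
  have hmuj := hμ j
  have hsumj : (μ + rootVec G n) j = μ j + rootVec G n j := rfl
  have hQ := rootVec_add_single_dotProduct_self (G := G) n j 1
  rw [hn.2, one_smul] at hQ
  have hpos : 0 < rootVec G (n + Pi.single j 1) ⬝ᵥ (n + Pi.single j 1) := by
    refine rootVec_dotProduct_self_pos hG fun h0 => ?_
    have := congrFun h0 j
    have h1 : (0 : ℤ) ≤ n j := hn.1 j
    simp at this
    omega
  have hm1 : rootVec G n j = -1 := by omega
  have hroot : IsPosRoot G (n + Pi.single j 1) :=
    ⟨add_nonneg hn.1 (Pi.single_nonneg.2 zero_le_one), by omega⟩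
  by_cases hlt : n j < b j
  · have hle : n + Pi.single j 1 ≤ b := by
      intro k
      rcases eq_or_ne k j with rfl | hk
      · simpa using hlt
      · simpa [hk] using hnb k
    have h1 : ∑ i, (n + Pi.single j 1 : I → ℤ) i = ∑ i, n i + 1 := by
      simp [Finset.sum_add_distrib]
    have := hmax ⟨hroot, hle⟩ (by simp only [h1]; omega)
    simp only [h1] at this
    omega
  · have hnbj : n j ≤ b j := hnb j
    have hd := hdom j
    have h1 : rootVec G (b - n) j ≤ 0 :=
      rootVec_apply_nonpos (sub_nonneg.2 hnb) (by simp only [Pi.sub_apply]; omega)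
    rw [rootVec_sub] at h1
    simp only [Pi.add_apply, Pi.sub_apply] at hd h1
    omega

end Roots

/-! ### Alternants and Weyl's denominator formula -/

section Alternant

open AddMonoidAlgebra

variable {G : SimpleGraph I} [DecidableRel G.Adj]

theorem det_simpleReflection (i : I) : LinearEquiv.det (simpleReflection G i) = -1 := by
  apply Units.ext
  have h : (simpleReflection G i : Weight I →ₗ[ℤ] Weight I) =
      LinearMap.transvection (-LinearMap.proj i) (simpleRoot G i) := by
    refine LinearMap.ext fun ξ => funext fun j => ?_
    simp [simpleReflection_apply, LinearMap.transvection.apply, sub_eq_add_neg]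
  rw [LinearEquiv.coe_det, h, LinearMap.transvection.det]
  simp [simpleRoot_apply, cartan_self]

/-- The determinant of a linear automorphism of the weight lattice, as an integer. -/
def sgn (w : Weight I ≃ₗ[ℤ] Weight I) : ℤ := ((LinearEquiv.det w : ℤˣ) : ℤ)

theorem sgn_mul (v w : Weight I ≃ₗ[ℤ] Weight I) : sgn (v * w) = sgn v * sgn w := by
  simp [sgn]

theorem sgn_one : sgn (1 : Weight I ≃ₗ[ℤ] Weight I) = 1 := by simp [sgn]

theorem sgn_mul_self (w : Weight I ≃ₗ[ℤ] Weight I) : sgn w * sgn w = 1 :=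
  Int.units_coe_mul_self _

theorem sgn_simpleReflection (i : I) : sgn (simpleReflection G i) = -1 := by
  simp [sgn, det_simpleReflection]

/-- The action of a linear automorphism of `P` on the group ring. -/
def act (w : Weight I ≃ₗ[ℤ] Weight I) :
    AddMonoidAlgebra ℤ (Weight I) ≃+* AddMonoidAlgebra ℤ (Weight I) :=
  AddMonoidAlgebra.mapDomainRingEquiv ℤ w.toAddEquiv

theorem act_single (w : Weight I ≃ₗ[ℤ] Weight I) (ξ : Weight I) (c : ℤ) :
    act w (single ξ c) = single (w ξ) c := by simp [act]

theorem coeff_act (w : Weight I ≃ₗ[ℤ] Weight I) (f : AddMonoidAlgebra ℤ (Weight I))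
    (ξ : Weight I) : (act w f).coeff (w ξ) = f.coeff ξ := by
  simp [act]

variable (G) in
/-- Invariance of an element of `ℤ[P]` under the Weyl group, in terms of the simple reflections. -/
def IsInvariant (V : AddMonoidAlgebra ℤ (Weight I)) : Prop :=
  ∀ i ξ, V.coeff (simpleReflection G i ξ) = V.coeff ξ

theorem IsInvariant.coeff_weylGroup {V : AddMonoidAlgebra ℤ (Weight I)} (hV : IsInvariant G V)
    {w : Weight I ≃ₗ[ℤ] Weight I} (hw : w ∈ weylGroup G) (ξ : Weight I) :
    V.coeff (w ξ) = V.coeff ξ := by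
  induction hw using Subgroup.closure_induction generalizing ξ with
  | mem x hx => obtain ⟨i, rfl⟩ := hx; exact hV i ξ
  | one => rfl
  | mul x y _ _ hx hy => rw [LinearEquiv.mul_apply, hx, hy]
  | inv x _ hx =>
    rw [← hx (x⁻¹ ξ)]
    change V.coeff (x (x.symm ξ)) = _
    simp

theorem IsInvariant.act_eq {V : AddMonoidAlgebra ℤ (Weight I)} (hV : IsInvariant G V)
    {w : Weight I ≃ₗ[ℤ] Weight I} (hw : w ∈ weylGroup G) : act w V = V := by
  ext ξ
  obtain ⟨η, rfl⟩ := w.surjective ξ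
  rw [coeff_act, hV.coeff_weylGroup hw]

variable (hG : IsADE G)
include hG

theorem alternant_eq_sum [Fintype (weylGroup G)] (ξ : Weight I) :
    alternant G ξ = ∑ w : weylGroup G, single ((w : Weight I ≃ₗ[ℤ] Weight I) ξ) (sgn w.1) :=
  finsum_eq_sum_of_fintype _

theorem alternant_weylGroup_apply {w : Weight I ≃ₗ[ℤ] Weight I} (hw : w ∈ weylGroup G)
    (ξ : Weight I) : alternant G (w ξ) = sgn w • alternant G ξ := by
  have := finite_weylGroup hG
  have := Fintype.ofFinite (weylGroup G)
  rw [alternant_eq_sum hG, alternant_eq_sum hG, Finset.smul_sum]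
  refine Fintype.sum_equiv (Equiv.mulRight ⟨w, hw⟩) _ _ fun v => ?_
  simp only [Equiv.coe_mulRight, Subgroup.coe_mul, LinearEquiv.mul_apply, sgn_mul,
    AddMonoidAlgebra.smul_single,
    smul_eq_mul]
  congr 1
  rw [mul_comm, mul_assoc, sgn_mul_self, mul_one]

theorem act_alternant {w : Weight I ≃ₗ[ℤ] Weight I} (hw : w ∈ weylGroup G) (ξ : Weight I) :
    act w (alternant G ξ) = sgn w • alternant G ξ := by
  have := finite_weylGroup hG
  have := Fintype.ofFinite (weylGroup G)
  rw [alternant_eq_sum hG, map_sum, Finset.smul_sum]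
  refine Fintype.sum_equiv (Equiv.mulLeft ⟨w, hw⟩) _ _ fun v => ?_
  simp only [Equiv.coe_mulLeft, Subgroup.coe_mul, LinearEquiv.mul_apply, sgn_mul,
    AddMonoidAlgebra.smul_single,
    smul_eq_mul, act_single]
  rw [← mul_assoc, sgn_mul_self, one_mul]

theorem alternant_eq_zero {ξ : Weight I} {i : I} (h : ξ i = 0) : alternant G ξ = 0 := by
  have h1 := alternant_weylGroup_apply hG (simpleReflection_mem_weylGroup i) ξ
  rw [simpleReflection_apply, h, zero_smul, sub_zero, sgn_simpleReflection, neg_one_smul] at h1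
  ext η
  have h2 := congrArg (fun f => f.coeff η) h1
  simp only [AddMonoidAlgebra.coeff_neg, Finsupp.neg_apply] at h2
  rw [self_eq_neg.1 h2]
  rfl

theorem alternant_eq_smul_domRep (ξ : Weight I) :
    ∃ c : ℤ, alternant G ξ = c • alternant G (domRep hG ξ) := by
  obtain ⟨w, hw, h⟩ := exists_weylGroup_apply_eq_domRep hG ξ
  refine ⟨sgn w, ?_⟩
  rw [← h, alternant_weylGroup_apply hG hw, smul_smul, sgn_mul_self, one_smul]

theorem coeff_alternant_of_pos {ξ η : Weight I} (hξ : ∀ i, 0 < ξ i) (hη : ∀ i, 0 < η i) :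
    (alternant G ξ).coeff η = if η = ξ then 1 else 0 := by
  have := finite_weylGroup hG
  have := Fintype.ofFinite (weylGroup G)
  rw [alternant_eq_sum hG, AddMonoidAlgebra.coeff_sum, Finsupp.finsetSum_apply]
  simp only [AddMonoidAlgebra.coeff_single, Finsupp.single_apply]
  have h : ∀ w : weylGroup G, w.1 ξ = η → η = ξ := by
    intro w hw
    rw [← domRep_of_isDominant hG (fun i => (hη i).le), ← hw, domRep_weylGroup hG w.2,
      domRep_of_isDominant hG (fun i => (hξ i).le)]
  split_ifs with heq
  · subst heq
    rw [Finset.sum_eq_single 1]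
    · simp [sgn_one]
    · intro w _ hne
      rw [if_neg fun hw => hne (Subtype.ext (eq_one_of_weylGroup_apply_eq hG w.2 hξ hw))]
    · simp
  · exact Finset.sum_eq_zero fun w _ => if_neg fun hw => heq (h w hw)

theorem alternant_rho_ne_zero : alternant G rho ≠ 0 := by
  intro h
  have := coeff_alternant_of_pos hG (ξ := rho) (η := rho) (fun _ => one_pos) (fun _ => one_pos)
  simp [h] at this

/-- An antisymmetric function on `P` is determined by its values on strictly dominant weights. -/
theorem eq_zero_of_antisymmetric {f : Weight I → ℤ}
    (hf : ∀ i ξ, f (simpleReflection G i ξ) = -f ξ)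
    (h0 : ∀ ξ, (∀ i, 0 < ξ i) → f ξ = 0) (ξ : Weight I) : f ξ = 0 := by
  induction ξ using ascent_induction hG with
  | h ξ ih =>
    by_cases hd : ∀ i, 0 < ξ i
    · exact h0 ξ hd
    · push Not at hd
      obtain ⟨i, hi⟩ := hd
      rcases hi.lt_or_eq with hi | hi
      · have := ih i hi
        rwa [hf, neg_eq_zero] at this
      · have := hf i ξ
        rw [simpleReflection_apply, hi, zero_smul, sub_zero] at this
        omega

theorem WeightLE.antisymm {ξ η : Weight I} (h₁ : WeightLE G ξ η) (h₂ : WeightLE G η ξ) :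
    ξ = η := by
  obtain ⟨m, hm, rfl⟩ := (weightLE_iff G).1 h₁
  obtain ⟨n, hn, h⟩ := (weightLE_iff G).1 h₂
  have h3 : m + n = 0 := by
    apply rootVec_injective hG
    rw [rootVec_add, rootVec_zero]
    rw [add_assoc] at h
    exact left_eq_add.1 h
  have : m = 0 := le_antisymm (by rw [← h3]; exact le_add_of_nonneg_right hn) hm
  rw [this, rootVec_zero, add_zero]

/-- A dominant weight in the negative of the positive cone is zero. -/
theorem eq_zero_of_isDominant_neg_rootVec {n : I → ℤ} (hn : 0 ≤ n)
    (h : IsDominant (-rootVec G n)) : n = 0 := by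
  have h1 := h.dotProduct_nonneg hn
  rw [neg_dotProduct] at h1
  rw [← rootVec_dotProduct_self_eq_zero hG]
  exact le_antisymm (by omega) (rootVec_dotProduct_self_nonneg hG n)

/-- The exponents of `∏_{β ∈ s} (1 - [-β])`, for `s` a set of positive roots. -/
theorem coeff_prod_one_sub_single {s : Finset (I → ℤ)} (hs : ∀ n ∈ s, IsPosRoot G n) :
    (∏ n ∈ s, (1 - single (-rootVec G n) (1 : ℤ))).coeff 0 = 1 ∧
      ∀ ξ, (∏ n ∈ s, (1 - single (-rootVec G n) (1 : ℤ))).coeff ξ ≠ 0 → WeightLE G ξ 0 := by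
  induction s using Finset.induction_on with
  | empty =>
    refine ⟨by simp, fun ξ hξ => ?_⟩
    have : ξ = 0 := by
      by_contra h
      simp [AddMonoidAlgebra.one_def, Ne.symm h] at hξ
    exact this ▸ weightLE_refl G _
  | insert n s hn ih =>
    obtain ⟨ih1, ih2⟩ := ih fun m hm => hs m (Finset.mem_insert_of_mem hm)
    have hroot := hs n (Finset.mem_insert_self _ _)
    rw [Finset.prod_insert hn, mul_comm, mul_sub, mul_one]
    have hlt : ∀ ξ, WeightLE G ξ 0 → WeightLE G (ξ - rootVec G n) 0 := fun ξ h =>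
      WeightLE.trans ((weightLE_iff G).2 ⟨n, hroot.1, by abel⟩) h
    simp only [AddMonoidAlgebra.coeff_sub, Finsupp.sub_apply, coeff_mul_single_apply, neg_neg,
      zero_add, mul_one]
    constructor
    · rw [ih1]
      by_contra hne
      have h1 : WeightLE G (rootVec G n) 0 := ih2 _ fun h => hne (by rw [h, sub_zero])
      have h2 : WeightLE G 0 (rootVec G n) := (weightLE_iff G).2 ⟨n, hroot.1, by rw [zero_add]⟩
      exact hroot.ne_zero (rootVec_injective hG
        ((WeightLE.antisymm hG h1 h2).trans (rootVec_zero G).symm))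
    · intro ξ hξ
      by_cases h : (∏ n ∈ s, (1 - single (-rootVec G n) (1 : ℤ))).coeff ξ = 0
      · rw [h, zero_sub, neg_ne_zero] at hξ
        simpa using hlt _ (ih2 _ hξ)
      · exact ih2 _ h

theorem act_simpleReflection_weylDenominator (i : I) :
    act (simpleReflection G i)
        (single rho 1 * ∏ n ∈ posRoots hG, (1 - single (-rootVec G n) (1 : ℤ))) =
      -(single rho 1 * ∏ n ∈ posRoots hG, (1 - single (-rootVec G n) (1 : ℤ))) := by
  have hi : Pi.single i 1 ∈ posRoots hG := (mem_posRoots hG).2 (isPosRoot_single i)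
  have hrho : simpleReflection G i rho = rho - simpleRoot G i := by
    rw [simpleReflection_apply]; simp [rho]
  have hself : simpleReflection G i (simpleRoot G i) = -simpleRoot G i :=
    Module.reflection_apply_self _
  have hperm : ∏ n ∈ (posRoots hG).erase (Pi.single i 1),
        act (simpleReflection G i) (1 - single (-rootVec G n) (1 : ℤ)) =
      ∏ n ∈ (posRoots hG).erase (Pi.single i 1), (1 - single (-rootVec G n) (1 : ℤ)) := by
    have hmem : ∀ n ∈ (posRoots hG).erase (Pi.single i 1),
        reflectRoot G i n ∈ (posRoots hG).erase (Pi.single i 1) := by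
      intro n hn
      rw [Finset.mem_erase, mem_posRoots] at hn ⊢
      refine ⟨fun h => ?_, hn.2.reflectRoot hG hn.1⟩
      have h1 : n = -Pi.single i 1 := by
        rw [← reflectRoot_involutive (G := G) i n, h]
        apply rootVec_injective hG
        rw [rootVec_reflectRoot, rootVec_neg, rootVec_single, hself]
      have h2 := hn.2.1 i
      rw [h1] at h2
      simp at h2
    refine Finset.prod_nbij' (reflectRoot G i) (reflectRoot G i) hmem hmem
      (fun n _ => reflectRoot_involutive i n) (fun n _ => reflectRoot_involutive i n) fun n _ => ?_
    rw [map_sub, map_one, act_single, map_neg, rootVec_reflectRoot]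
  rw [← Finset.mul_prod_erase _ _ hi, map_mul, map_mul, map_prod, hperm, ← mul_assoc, ← mul_assoc,
    ← neg_mul]
  congr 1
  rw [act_single, map_sub, map_one, act_single, map_neg, rootVec_single, hself, hrho, mul_sub,
    mul_sub, mul_one, mul_one, single_mul_single, single_mul_single, neg_sub, neg_neg,
    sub_add_cancel, sub_eq_add_neg rho, mul_one]

/-- Weyl's denominator formula. Both sides are antisymmetric, and `ρ` is the only strictly dominant
weight that is `≤ ρ`. -/
theorem alternant_rho :
    alternant G rho = single rho 1 * ∏ n ∈ posRoots hG, (1 - single (-rootVec G n) (1 : ℤ)) := by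
  set D := single rho 1 * ∏ n ∈ posRoots hG, (1 - single (-rootVec G n) (1 : ℤ)) with hD
  obtain ⟨h1, h2⟩ := coeff_prod_one_sub_single hG (s := posRoots hG)
    fun n hn => (mem_posRoots hG).1 hn
  have hcoeff : ∀ ξ, D.coeff ξ =
      (∏ n ∈ posRoots hG, (1 - single (-rootVec G n) (1 : ℤ))).coeff (-rho + ξ) := by
    intro ξ; rw [hD, coeff_single_mul_apply, one_mul]
  rw [← sub_eq_zero]
  ext ξ
  refine eq_zero_of_antisymmetric hG (f := fun ξ => (alternant G rho - D).coeff ξ) ?_ ?_ ξ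
  · intro i ξ
    have ha := coeff_act (simpleReflection G i) (alternant G rho) ξ
    have hd := coeff_act (simpleReflection G i) D ξ
    rw [act_alternant hG (simpleReflection_mem_weylGroup i), sgn_simpleReflection, neg_one_smul,
      AddMonoidAlgebra.coeff_neg, Finsupp.neg_apply] at ha
    rw [hD, act_simpleReflection_weylDenominator hG, ← hD,
      AddMonoidAlgebra.coeff_neg, Finsupp.neg_apply] at hd
    simp only [AddMonoidAlgebra.coeff_sub, Finsupp.sub_apply]
    omega
  · intro ξ hξ
    simp only [AddMonoidAlgebra.coeff_sub, Finsupp.sub_apply]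
    rw [coeff_alternant_of_pos hG (ξ := rho) (fun _ => one_pos) hξ, hcoeff]
    split_ifs with h
    · rw [h, neg_add_cancel, h1, sub_self]
    · by_contra hne
      obtain ⟨n, hn, hn'⟩ := (weightLE_iff G).1 (h2 (-rho + ξ) fun h0 => hne (by rw [h0, sub_zero]))
      have h3 : ξ - rho = -rootVec G n := by
        rw [eq_neg_iff_add_eq_zero, hn']; abel
      have h4 := eq_zero_of_isDominant_neg_rootVec hG hn (by
        rw [← h3]; intro i; have := hξ i; simp [rho]; omega)
      rw [h4, rootVec_zero, neg_zero, sub_eq_zero] at h3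
      exact h h3

end Alternant

/-! ### Weyl characters -/

section Character

open AddMonoidAlgebra

variable {G : SimpleGraph I} [DecidableRel G.Adj] (hG : IsADE G)
include hG

theorem finite_domRep_eq (lam : Weight I) : {ξ | domRep hG ξ = lam}.Finite := by
  refine (finite_form_self_le hG (form G lam lam)).subset fun ξ hξ => ?_
  have h : domRep hG ξ = lam := hξ
  rw [Set.mem_ofPred_eq, ← form_domRep hG, h]

/-- The sum of the elements of the Weyl group orbit with the dominant element `lam`. -/
def orbitSum (lam : Weight I) : AddMonoidAlgebra ℤ (Weight I) :=
  ∑ ξ ∈ (finite_domRep_eq hG lam).toFinset, single ξ 1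

theorem coeff_orbitSum (lam ξ : Weight I) :
    (orbitSum hG lam).coeff ξ = if domRep hG ξ = lam then 1 else 0 := by
  rw [orbitSum, AddMonoidAlgebra.coeff_sum, Finsupp.finsetSum_apply]
  simp [Finsupp.single_apply]

theorem isInvariant_orbitSum (lam : Weight I) : IsInvariant G (orbitSum hG lam) := by
  intro i ξ
  rw [coeff_orbitSum, coeff_orbitSum, domRep_simpleReflection]

theorem orbitSum_mul_alternant (lam μ : Weight I) :
    orbitSum hG lam * alternant G μ =
      ∑ ξ ∈ (finite_domRep_eq hG lam).toFinset, alternant G (ξ + μ) := by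
  have := finite_weylGroup hG
  have := Fintype.ofFinite (weylGroup G)
  simp only [alternant_eq_sum hG]
  rw [Finset.mul_sum, Finset.sum_comm]
  refine Finset.sum_congr rfl fun w _ => ?_
  rw [← (isInvariant_orbitSum hG lam).act_eq w.2, ← act_single, ← map_mul, orbitSum,
    Finset.sum_mul, map_sum]
  simp [single_mul_single, act_single]

/-- Weyl's formula defines an element of `ℤ[P]`. By induction on `lam`: the product of the alternant
of `ρ` with the orbit sum of `lam` is the sum of the alternants of `ξ + ρ` with `ξ` in the orbit,
and those with `ξ ≠ lam` are zero or are, up to sign, alternants of `μ + ρ` with `μ < lam`. -/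
theorem exists_character {lam : Weight I} (hlam : IsDominant lam) :
    ∃ V, alternant G (lam + rho) = V * alternant G rho ∧ IsInvariant G V ∧
      (∀ ξ, V.coeff ξ ≠ 0 → WeightLE G ξ lam) ∧ V.coeff lam = 1 := by
  induction hn : ⌊form G (lam + rho) (lam + rho)⌋₊ using Nat.strong_induction_on
    generalizing lam with
  | _ n ih =>
  subst hn
  set O := (finite_domRep_eq hG lam).toFinset with hO
  have hlamO : lam ∈ O := by simp [hO, domRep_of_isDominant hG hlam]
  have key : ∀ ξ ∈ O.erase lam, ∃ U, alternant G (ξ + rho) = U * alternant G rho ∧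
      IsInvariant G U ∧ (∀ η, U.coeff η ≠ 0 → WeightLE G η lam) ∧ U.coeff lam = 0 := by
    intro ξ hξ
    obtain ⟨hne, hξO⟩ := Finset.mem_erase.1 hξ
    have hdom : domRep hG ξ = lam := by simpa [hO] using hξO
    obtain ⟨w, hw, hwμ⟩ := exists_weylGroup_apply_eq_domRep hG (ξ + rho)
    set μ := domRep hG (ξ + rho) with hμ
    have hμd : IsDominant μ := isDominant_domRep hG _
    obtain ⟨c, hc⟩ := alternant_eq_smul_domRep hG (ξ + rho)
    by_cases hpos : ∀ i, 0 < μ i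
    · have hd : IsDominant (μ - rho) := by
        intro i; have := hpos i; simp only [Pi.sub_apply, rho]; omega
      obtain ⟨a, ha, ha'⟩ := (weightLE_iff G).1 (weightLE_domRep hG (w ξ))
      obtain ⟨b, hb, hb'⟩ := (weightLE_iff G).1 (weylGroup_apply_weightLE hG
        (ξ := rho) (fun _ => zero_le_one) hw)
      rw [domRep_weylGroup hG hw, hdom] at ha'
      have hsum : lam = μ - rho + rootVec G (a + b) := by
        rw [← hwμ, map_add, rootVec_add, ha']
        have hb2 : rootVec G b = rho - w rho := by rw [eq_sub_iff_add_eq', ← hb']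
        rw [hb2]
        abel
      have hab : a + b ≠ 0 := by
        intro h0
        have ha0 : a = 0 := le_antisymm (by rw [← h0]; exact le_add_of_nonneg_right hb) ha
        have hb0 : b = 0 := by rwa [ha0, zero_add] at h0
        rw [hb0, rootVec_zero, add_zero] at hb'
        have h1 := eq_one_of_weylGroup_apply_eq hG hw (μ := rho) (fun _ => one_pos) hb'.symm
        rw [ha0, rootVec_zero, add_zero, h1] at ha'
        exact hne ha'.symm
      have hab0 : 0 ≤ a + b := add_nonneg ha hb
      have hle : WeightLE G (μ - rho) lam := (weightLE_iff G).2 ⟨_, hab0, hsum⟩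
      have hlt : ⌊form G (μ - rho + rho) (μ - rho + rho)⌋₊ <
          ⌊form G (lam + rho) (lam + rho)⌋₊ := by
        refine floor_lt_floor_of_add_one_le (form_self_nonneg hG _) ?_
        have h1 : lam + rho = μ - rho + rho + rootVec G (a + b) := by
          nth_rewrite 1 [hsum]; abel
        rw [h1, form_self_add_rootVec hG, sub_add_cancel]
        have h2 := hμd.dotProduct_nonneg hab0
        have h3 := rootVec_dotProduct_self_pos hG hab
        have h4 : (1 : ℤ) ≤ 2 * (μ ⬝ᵥ (a + b)) + rootVec G (a + b) ⬝ᵥ (a + b) := by omega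
        have h5 : (1 : ℚ) ≤ ((2 * (μ ⬝ᵥ (a + b)) + rootVec G (a + b) ⬝ᵥ (a + b) : ℤ) : ℚ) := by
          exact_mod_cast h4
        linarith
      obtain ⟨V, hV1, hV2, hV3, hV4⟩ := ih _ hlt hd rfl
      refine ⟨c • V, ?_, ?_, ?_, ?_⟩
      · rw [hc, smul_mul_assoc, ← hV1, sub_add_cancel]
      · intro i η
        rw [AddMonoidAlgebra.coeff_smul_apply, AddMonoidAlgebra.coeff_smul_apply, hV2 i η]
      · intro η hη
        refine (hV3 η fun h => hη ?_).trans hle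
        rw [AddMonoidAlgebra.coeff_smul_apply, h, smul_zero]
      · have : V.coeff lam = 0 := by
          by_contra h
          have := WeightLE.antisymm hG (hV3 _ h) hle
          rw [← this] at hsum
          exact hab (rootVec_injective hG ((left_eq_add.1 hsum).trans (rootVec_zero G).symm))
        rw [AddMonoidAlgebra.coeff_smul_apply, this, smul_zero]
    · push Not at hpos
      obtain ⟨i, hi⟩ := hpos
      refine ⟨0, ?_, fun _ _ => rfl, fun η hη => absurd rfl hη, rfl⟩
      rw [hc, alternant_eq_zero hG (le_antisymm hi (hμd i)), smul_zero, zero_mul]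
  choose! U hU1 hU2 hU3 hU4 using key
  refine ⟨orbitSum hG lam - ∑ ξ ∈ O.erase lam, U ξ, ?_, ?_, ?_, ?_⟩
  · rw [sub_mul, orbitSum_mul_alternant, ← hO, ← Finset.add_sum_erase _ _ hlamO, Finset.sum_mul,
      Finset.sum_congr rfl hU1, add_sub_cancel_right]
  · intro i ξ
    simp only [AddMonoidAlgebra.coeff_sub, Finsupp.sub_apply, AddMonoidAlgebra.coeff_sum,
      Finsupp.finsetSum_apply]
    rw [isInvariant_orbitSum hG lam i ξ, Finset.sum_congr rfl fun η hη => hU2 η hη i ξ]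
  · intro ξ hξ
    by_contra hle
    apply hξ
    simp only [AddMonoidAlgebra.coeff_sub, Finsupp.sub_apply, AddMonoidAlgebra.coeff_sum,
      Finsupp.finsetSum_apply]
    rw [coeff_orbitSum, if_neg, Finset.sum_eq_zero, sub_zero]
    · intro η hη
      by_contra h
      exact hle (hU3 η hη ξ h)
    · rintro rfl
      exact hle (weightLE_domRep hG ξ)
  · simp only [AddMonoidAlgebra.coeff_sub, Finsupp.sub_apply, AddMonoidAlgebra.coeff_sum,
      Finsupp.finsetSum_apply]
    rw [coeff_orbitSum, if_pos (domRep_of_isDominant hG hlam), Finset.sum_eq_zero hU4, sub_zero]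

theorem weylCharacter_spec {lam : Weight I} (hlam : IsDominant lam) :
    alternant G (lam + rho) = weylCharacter G lam * alternant G rho ∧
      IsInvariant G (weylCharacter G lam) ∧
      (∀ ξ, (weylCharacter G lam).coeff ξ ≠ 0 → WeightLE G ξ lam) ∧
      (weylCharacter G lam).coeff lam = 1 := by
  obtain ⟨V, hV⟩ := exists_character hG hlam
  have hex : ∃ V, alternant G (lam + rho) = V * alternant G rho := ⟨V, hV.1⟩
  have h1 : alternant G (lam + rho) = weylCharacter G lam * alternant G rho := by
    rw [weylCharacter, dif_pos hex]; exact hex.choose_spec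
  have h2 : weylCharacter G lam = V :=
    mul_right_cancel₀ (alternant_rho_ne_zero hG) (h1.symm.trans hV.1)
  rw [h2]
  exact hV

end Character

/-! ### Freudenthal's formula and the positivity of weight multiplicities -/

section Freudenthal

open AddMonoidAlgebra

/-- The operator on `ℚ[P]` that multiplies the coefficient of `[ξ]` by `φ ξ`. -/
def multiplier (φ : Weight I → ℚ) :
    AddMonoidAlgebra ℚ (Weight I) →ₗ[ℚ] AddMonoidAlgebra ℚ (Weight I) where
  toFun f := .ofCoeff (Finsupp.onFinset f.coeff.support (fun ξ => φ ξ * f.coeff ξ) fun ξ h =>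
    Finsupp.mem_support_iff.2 (right_ne_zero_of_mul h))
  map_add' f g := by ext ξ; exact mul_add _ _ _
  map_smul' c f := by ext ξ; exact mul_left_comm _ _ _

theorem coeff_multiplier (φ : Weight I → ℚ) (f : AddMonoidAlgebra ℚ (Weight I)) (ξ : Weight I) :
    (multiplier φ f).coeff ξ = φ ξ * f.coeff ξ := rfl

theorem multiplier_single (φ : Weight I → ℚ) (ξ : Weight I) (a : ℚ) :
    multiplier φ (single ξ a) = single ξ (φ ξ * a) := by
  ext η
  rw [coeff_multiplier]
  simp only [AddMonoidAlgebra.coeff_single, Finsupp.single_apply]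
  split_ifs with h
  · rw [h]
  · rw [mul_zero]

variable (G : SimpleGraph I) [DecidableRel G.Adj]

/-- The Laplacian `[ξ] ↦ (ξ, ξ) [ξ]` on `ℚ[P]`. -/
def laplacian : AddMonoidAlgebra ℚ (Weight I) →ₗ[ℚ] AddMonoidAlgebra ℚ (Weight I) :=
  multiplier fun ξ => form G ξ ξ

/-- Twice the product of the gradients: the deviation of the Laplacian from the Leibniz rule. -/
def gradProd (f g : AddMonoidAlgebra ℚ (Weight I)) : AddMonoidAlgebra ℚ (Weight I) :=
  laplacian G (f * g) - f * laplacian G g - laplacian G f * g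

theorem gradProd_add_left (f₁ f₂ g : AddMonoidAlgebra ℚ (Weight I)) :
    gradProd G (f₁ + f₂) g = gradProd G f₁ g + gradProd G f₂ g := by
  simp only [gradProd, add_mul, map_add]; ring

theorem gradProd_add_right (f g₁ g₂ : AddMonoidAlgebra ℚ (Weight I)) :
    gradProd G f (g₁ + g₂) = gradProd G f g₁ + gradProd G f g₂ := by
  simp only [gradProd, mul_add, map_add]; ring

theorem gradProd_zero_left (g : AddMonoidAlgebra ℚ (Weight I)) : gradProd G 0 g = 0 := by
  simp [gradProd]

theorem gradProd_zero_right (f : AddMonoidAlgebra ℚ (Weight I)) : gradProd G f 0 = 0 := by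
  simp [gradProd]

theorem gradProd_single_single (ξ η : Weight I) (a b : ℚ) :
    gradProd G (single ξ a) (single η b) = single (ξ + η) (2 * form G ξ η * (a * b)) := by
  simp only [gradProd, laplacian, single_mul_single, multiplier_single, form_add_left,
    form_add_right, form_comm G η ξ]
  rw [← AddMonoidAlgebra.single_sub, ← AddMonoidAlgebra.single_sub]
  congr 1
  ring

theorem gradProd_mul (f g h : AddMonoidAlgebra ℚ (Weight I)) :
    gradProd G f (g * h) = g * gradProd G f h + h * gradProd G f g := by
  induction f using AddMonoidAlgebra.induction_linear with
  | zero => simp [gradProd_zero_left]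
  | add f₁ f₂ h₁ h₂ => simp only [gradProd_add_left, h₁, h₂]; ring
  | single ξ a =>
    induction g using AddMonoidAlgebra.induction_linear with
    | zero => simp [gradProd_zero_right]
    | add g₁ g₂ h₁ h₂ => simp only [add_mul, mul_add, gradProd_add_right, h₁, h₂]; ring
    | single η b =>
      induction h using AddMonoidAlgebra.induction_linear with
      | zero => simp [gradProd_zero_right]
      | add h₁ h₂ e₁ e₂ => simp only [add_mul, mul_add, gradProd_add_right, e₁, e₂]; ring
      | single ζ c =>
        simp only [single_mul_single, gradProd_single_single, form_add_right]
        rw [show η + (ξ + ζ) = ξ + (η + ζ) by abel, show ζ + (ξ + η) = ξ + (η + ζ) by abel,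
          ← AddMonoidAlgebra.single_add]
        congr 1
        ring

theorem gradProd_single_right (f : AddMonoidAlgebra ℚ (Weight I)) (η : Weight I) :
    gradProd G f (single η 1) = 2 * multiplier (fun ξ => form G ξ η) f * single η 1 := by
  induction f using AddMonoidAlgebra.induction_linear with
  | zero => simp [gradProd_zero_left]
  | add f₁ f₂ h₁ h₂ => simp only [gradProd_add_left, h₁, h₂, map_add]; ring
  | single ξ a =>
    rw [gradProd_single_single, multiplier_single,
      mul_assoc (2 : AddMonoidAlgebra ℚ (Weight I)), single_mul_single,
      two_mul (single _ _ : AddMonoidAlgebra ℚ (Weight I)), ← AddMonoidAlgebra.single_add]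
    congr 1
    ring

theorem gradProd_one_right (f : AddMonoidAlgebra ℚ (Weight I)) : gradProd G f 1 = 0 := by
  have h : multiplier (fun ξ => form G ξ 0) f = 0 := by
    ext ξ; rw [coeff_multiplier]; simp [form]
  rw [AddMonoidAlgebra.one_def, gradProd_single_right, h, mul_zero, zero_mul]

variable {G} (hG : IsADE G)
include hG

theorem gradProd_one_sub_single (f : AddMonoidAlgebra ℚ (Weight I)) (n : I → ℤ) :
    gradProd G f (1 - single (-rootVec G n) 1) =
      2 * (multiplier (fun ξ => ((ξ ⬝ᵥ n : ℤ) : ℚ)) f * single (-rootVec G n) 1) := by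
  have h1 := gradProd_add_right G f (1 - single (-rootVec G n) 1) (single (-rootVec G n) 1)
  rw [sub_add_cancel, gradProd_one_right, gradProd_single_right] at h1
  have h2 : multiplier (fun ξ => form G ξ (-rootVec G n)) f =
      -multiplier (fun ξ => ((ξ ⬝ᵥ n : ℤ) : ℚ)) f := by
    ext ξ
    rw [AddMonoidAlgebra.coeff_neg, Finsupp.neg_apply, coeff_multiplier, coeff_multiplier,
      form_neg_right, form_rootVec hG, neg_mul]
  rw [h2] at h1
  linear_combination -h1

/-- Logarithmic differentiation of a product over positive roots. -/
theorem gradProd_prod (f : AddMonoidAlgebra ℚ (Weight I)) (s : Finset (I → ℤ))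
    (U : (I → ℤ) → AddMonoidAlgebra ℚ (Weight I))
    (hU : ∀ n ∈ s, (1 - single (-rootVec G n) 1) * U n =
      multiplier (fun ξ => ((ξ ⬝ᵥ n : ℤ) : ℚ)) f * single (-rootVec G n) 1) :
    gradProd G f (∏ n ∈ s, (1 - single (-rootVec G n) 1)) =
      2 * (∏ n ∈ s, (1 - single (-rootVec G n) 1)) * ∑ n ∈ s, U n := by
  induction s using Finset.induction_on with
  | empty => simp [gradProd_one_right]
  | insert n s hn ih =>
    rw [Finset.prod_insert hn, Finset.sum_insert hn, gradProd_mul, gradProd_one_sub_single hG,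
      ← hU n (Finset.mem_insert_self _ _), ih fun m hm => hU m (Finset.mem_insert_of_mem hm)]
    ring

/-- The reflection `ξ ↦ ξ - (ξ, β) β` in the root `β = ∑ i, n i • α i`. -/
def rootReflection (G : SimpleGraph I) [DecidableRel G.Adj] (n : I → ℤ) (ξ : Weight I) :
    Weight I := ξ - (ξ ⬝ᵥ n) • rootVec G n

omit hG in
theorem rootReflection_dotProduct {n : I → ℤ} (hn : IsPosRoot G n) (ξ : Weight I) :
    rootReflection G n ξ ⬝ᵥ n = -(ξ ⬝ᵥ n) := by
  rw [rootReflection, sub_dotProduct, smul_dotProduct, hn.2, smul_eq_mul]; ring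

omit hG in
theorem rootReflection_involutive {n : I → ℤ} (hn : IsPosRoot G n) :
    Function.Involutive (rootReflection G n) := by
  intro ξ
  rw [rootReflection, rootReflection_dotProduct hn, rootReflection, neg_smul, sub_neg_eq_add,
    sub_add_cancel]

/-- Elements of `ℤ[P]` that are invariant under the simple reflections are invariant under all
reflections. -/
theorem IsInvariant.coeff_rootReflection {V : AddMonoidAlgebra ℤ (Weight I)}
    (hV : IsInvariant G V) {n : I → ℤ} (hn : IsPosRoot G n) (ξ : Weight I) :
    V.coeff (rootReflection G n ξ) = V.coeff ξ := by
  refine posRoot_induction hG (p := fun n => ∀ ξ, V.coeff (rootReflection G n ξ) = V.coeff ξ)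
    (fun i ξ => ?_) (fun n i _ ih ξ => ?_) hn ξ
  · rw [← hV i ξ, rootReflection, rootVec_single, dotProduct_single_one, simpleReflection_apply]
  · have h1 : simpleReflection G i ξ ⬝ᵥ reflectRoot G i n = ξ ⬝ᵥ n := by
      have := form_simpleReflection hG i ξ (rootVec G n)
      rw [← rootVec_reflectRoot, form_rootVec hG, form_rootVec hG] at this
      exact_mod_cast this
    have h2 : rootReflection G n ξ = simpleReflection G i
        (rootReflection G (reflectRoot G i n) (simpleReflection G i ξ)) := by
      rw [rootReflection, rootReflection, h1, map_sub, map_smul, rootVec_reflectRoot,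
        simpleReflection_involutive, simpleReflection_involutive]
    rw [h2, hV, ih, hV]

omit hG in
theorem one_sub_single_dvd_single_sub_single (ξ : Weight I) (n : I → ℤ) (k : ℤ) (a : ℚ) :
    (1 - single (-rootVec G n) (1 : ℚ)) ∣ single ξ a - single (ξ - k • rootVec G n) a := by
  have hnat : ∀ (k : ℕ) (ξ : Weight I), (1 - single (-rootVec G n) (1 : ℚ)) ∣
      single ξ a - single (ξ - k • rootVec G n) a := by
    intro k ξ
    have h : single ξ a - single (ξ - k • rootVec G n) a =
        (1 - single (-rootVec G n) (1 : ℚ) ^ k) * single ξ a := by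
      rw [AddMonoidAlgebra.single_pow, one_pow, sub_mul, one_mul, single_mul_single, one_mul,
        smul_neg, neg_add_eq_sub]
    rw [h]
    refine Dvd.dvd.mul_right ?_ _
    simpa using sub_dvd_pow_sub_pow 1 (single (-rootVec G n) (1 : ℚ)) k
  rcases Int.eq_nat_or_neg k with ⟨m, rfl | rfl⟩
  · rw [natCast_zsmul]; exact hnat m ξ
  · rw [neg_smul, natCast_zsmul, sub_neg_eq_add, ← neg_sub (single _ a), dvd_neg]
    simpa using hnat m (ξ + m • rootVec G n)

omit hG in
theorem one_sub_single_dvd_of_antisymmetric {n : I → ℤ} (hn : IsPosRoot G n)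
    {f : AddMonoidAlgebra ℚ (Weight I)}
    (hf : ∀ ξ, f.coeff (rootReflection G n ξ) = -f.coeff ξ) :
    (1 - single (-rootVec G n) (1 : ℚ)) ∣ f := by
  have h1 : ∀ f : AddMonoidAlgebra ℚ (Weight I), (1 - single (-rootVec G n) (1 : ℚ)) ∣
      f - AddMonoidAlgebra.mapDomain (rootReflection G n) f := by
    intro f
    induction f using AddMonoidAlgebra.induction_linear with
    | zero => simp
    | add f g hf hg =>
      rw [AddMonoidAlgebra.mapDomain_add, add_sub_add_comm]
      exact dvd_add hf hg
    | single ξ a =>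
      rw [AddMonoidAlgebra.mapDomain_single]
      exact one_sub_single_dvd_single_sub_single ξ n _ a
  have h2 : AddMonoidAlgebra.mapDomain (rootReflection G n) f = -f := by
    ext ξ
    obtain ⟨η, rfl⟩ := (rootReflection_involutive hn).surjective ξ
    rw [AddMonoidAlgebra.coeff_neg, Finsupp.neg_apply, hf, neg_neg]
    exact Finsupp.mapDomain_apply (rootReflection_involutive hn).injective _ _
  have h3 := h1 f
  rw [h2, sub_neg_eq_add] at h3
  have h4 : f = single 0 (1 / 2 : ℚ) * (f + f) := by
    ext ξ
    rw [coeff_single_mul_apply]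
    simp
    ring
  rw [h4]
  exact h3.mul_left _

/-- An element of `ℤ[P]`, as an element of `ℚ[P]`. -/
def toRat : AddMonoidAlgebra ℤ (Weight I) →+* AddMonoidAlgebra ℚ (Weight I) :=
  AddMonoidAlgebra.mapRingHom (Weight I) (Int.castRingHom ℚ)

omit hG in
theorem coeff_toRat (V : AddMonoidAlgebra ℤ (Weight I)) (ξ : Weight I) :
    (toRat V).coeff ξ = (V.coeff ξ : ℚ) := by simp [toRat]

omit hG in
theorem toRat_single (ξ : Weight I) (a : ℤ) : toRat (single ξ a) = single ξ (a : ℚ) := by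
  simp [toRat]

theorem laplacian_alternant (ξ : Weight I) :
    laplacian G (toRat (alternant G ξ)) = form G ξ ξ • toRat (alternant G ξ) := by
  have := finite_weylGroup hG
  have := Fintype.ofFinite (weylGroup G)
  rw [alternant_eq_sum hG, map_sum, map_sum, Finset.smul_sum]
  refine Finset.sum_congr rfl fun w _ => ?_
  rw [toRat_single, laplacian, multiplier_single, AddMonoidAlgebra.smul_single, smul_eq_mul,
    form_weylGroup hG w.2]

/-- Freudenthal's formula, in the form of a recursion: here `U n` has the coefficient
`∑_{k ≥ 1} (ξ + k β, β) (ξ + k β : V)` at `ξ`, where `β = ∑ i, n i • α i`. It is obtained by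
applying the Laplacian to Weyl's formula. -/
theorem freudenthal {lam : Weight I} (hlam : IsDominant lam) :
    ∃ U : (I → ℤ) → AddMonoidAlgebra ℚ (Weight I),
      (∀ n ∈ posRoots hG, ∀ ξ, (U n).coeff ξ = (U n).coeff (ξ + rootVec G n) +
        (((ξ + rootVec G n) ⬝ᵥ n : ℤ) : ℚ) * (weylCharacter G lam).coeff (ξ + rootVec G n)) ∧
      ∀ ξ, (form G (lam + rho) (lam + rho) - form G (ξ + rho) (ξ + rho)) *
        (weylCharacter G lam).coeff ξ = 2 * ∑ n ∈ posRoots hG, (U n).coeff ξ := by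
  obtain ⟨hchar, hinv, -, -⟩ := weylCharacter_spec hG hlam
  set V := toRat (weylCharacter G lam) with hV
  have hex : ∀ n ∈ posRoots hG, ∃ U, (1 - single (-rootVec G n) 1) * U =
      multiplier (fun ξ => ((ξ ⬝ᵥ n : ℤ) : ℚ)) V * single (-rootVec G n) 1 := by
    intro n hn
    have hroot := (mem_posRoots hG).1 hn
    obtain ⟨U, hU⟩ := one_sub_single_dvd_of_antisymmetric hroot
      (f := multiplier (fun ξ => ((ξ ⬝ᵥ n : ℤ) : ℚ)) V) fun ξ => by
        rw [coeff_multiplier, coeff_multiplier, rootReflection_dotProduct hroot, hV, coeff_toRat,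
          coeff_toRat, hinv.coeff_rootReflection hG hroot]
        push_cast; ring
    exact ⟨U * single (-rootVec G n) 1, by rw [← mul_assoc, ← hU]⟩
  choose! U hU using hex
  refine ⟨U, ?_, ?_⟩
  · intro n hn ξ
    have h := congrArg (fun f => f.coeff ξ) (hU n hn)
    simp only [sub_mul, one_mul, AddMonoidAlgebra.coeff_sub, Finsupp.sub_apply,
      coeff_single_mul_apply, coeff_mul_single_apply, coeff_multiplier, neg_neg, mul_one] at h
    rw [hV, coeff_toRat, add_comm (rootVec G n) ξ] at h
    linear_combination h
  · intro ξ
    set D := toRat (alternant G rho) with hD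
    have hD0 : D ≠ 0 := by
      intro h0
      apply alternant_rho_ne_zero hG
      ext ξ
      have := congrArg (fun f => f.coeff ξ) h0
      simp only [hD, coeff_toRat, AddMonoidAlgebra.coeff_zero, Finsupp.zero_apply] at this
      rw [AddMonoidAlgebra.coeff_zero, Finsupp.zero_apply]
      exact_mod_cast this
    have hDprod : D = single rho 1 * ∏ n ∈ posRoots hG, (1 - single (-rootVec G n) (1 : ℚ)) := by
      rw [hD, alternant_rho hG, map_mul, map_prod, toRat_single]
      simp [toRat_single]
    have hgrad : gradProd G V D =
        2 * D * (multiplier (fun ξ => form G ξ rho) V + ∑ n ∈ posRoots hG, U n) := by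
      rw [hDprod, gradProd_mul, gradProd_prod hG V _ U hU, gradProd_single_right]
      ring
    have hlap : laplacian G (V * D) = form G (lam + rho) (lam + rho) • (V * D) := by
      rw [hV, hD, ← map_mul, ← hchar, laplacian_alternant hG]
    rw [gradProd, hlap, hD, laplacian_alternant hG, ← hD] at hgrad
    have hmain : (form G (lam + rho) (lam + rho) - form G rho rho) • V - laplacian G V =
        2 * (multiplier (fun ξ => form G ξ rho) V + ∑ n ∈ posRoots hG, U n) := by
      apply mul_right_cancel₀ hD0
      rw [sub_mul, smul_mul_assoc, sub_smul]
      rw [mul_smul_comm] at hgrad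
      linear_combination hgrad
    have h := congrArg (fun f => f.coeff ξ) hmain
    simp only [two_mul, AddMonoidAlgebra.coeff_sub, Finsupp.sub_apply, laplacian, coeff_multiplier,
      AddMonoidAlgebra.coeff_add, Finsupp.add_apply, AddMonoidAlgebra.coeff_sum,
      Finsupp.finsetSum_apply, AddMonoidAlgebra.coeff_smul_apply, smul_eq_mul] at h
    rw [hV, coeff_toRat] at h
    rw [form_add_left G ξ, form_add_right G ξ, form_add_right G rho, form_comm G rho ξ]
    linear_combination h

/-- The multiplicity in `V_lam` of a dominant weight `μ ≤ lam` is positive: in Freudenthal's formula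
for dominant `μ` all terms are nonnegative by induction, and they are not all zero. -/
theorem weightMult_pos {lam : Weight I} (hlam : IsDominant lam) {μ : Weight I}
    (hμ : IsDominant μ) (hle : WeightLE G μ lam) : 0 < weightMult G μ lam := by
  obtain ⟨-, hinv, hsupp, hone⟩ := weylCharacter_spec hG hlam
  obtain ⟨U, hU, hfreud⟩ := freudenthal hG hlam
  set V := weylCharacter G lam with hV
  change 0 < V.coeff μ
  obtain ⟨b, hb, hbeq⟩ := (weightLE_iff G).1 hle
  clear hle
  induction hk : (∑ i, b i).toNat using Nat.strong_induction_on generalizing μ b with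
  | _ k ih =>
  subst hk
  have hsum_pos : ∀ c : I → ℤ, 0 ≤ c → c ≠ 0 → 0 < ∑ i, c i := by
    intro c hc hc0
    refine (Finset.sum_nonneg fun i _ => hc i).lt_of_ne fun h => hc0 ?_
    ext i
    exact (Finset.sum_eq_zero_iff_of_nonneg fun i _ => hc i).1 h.symm i (Finset.mem_univ i)
  by_cases hb0 : b = 0
  · rw [hb0, rootVec_zero, add_zero] at hbeq
    rw [← hbeq, hone]; exact one_pos
  -- the induction hypothesis, for weights that need not be dominant
  have hnonneg : ∀ c : I → ℤ, 0 ≤ c → c ≠ 0 → 0 ≤ V.coeff (μ + rootVec G c) := by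
    intro c hc hc0
    by_contra hneg
    set ξ := μ + rootVec G c with hξ
    obtain ⟨w, hw, hwξ⟩ := exists_weylGroup_apply_eq_domRep hG ξ
    have hcoeff : V.coeff (domRep hG ξ) = V.coeff ξ := by rw [← hwξ, hinv.coeff_weylGroup hw]
    have hne : V.coeff (domRep hG ξ) ≠ 0 := by omega
    obtain ⟨d, hd, hdeq⟩ := (weightLE_iff G).1 (weightLE_domRep hG ξ)
    obtain ⟨e, he, heeq⟩ := (weightLE_iff G).1 (hsupp _ hne)
    have hbcde : b = c + d + e := by
      apply rootVec_injective hG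
      rw [hdeq, hbeq, hξ] at heeq
      rw [rootVec_add, rootVec_add]
      have := congrArg (fun x => x - μ) heeq
      simp only [add_sub_cancel_left] at this
      rw [this]; abel
    have := ih _ ?_ (isDominant_domRep hG ξ) e he heeq rfl
    · omega
    · have h1 := hsum_pos c hc hc0
      have h2 : 0 ≤ ∑ i, d i := Finset.sum_nonneg fun i _ => hd i
      have h3 : 0 ≤ ∑ i, e i := Finset.sum_nonneg fun i _ => he i
      have h4 : ∑ i, b i = ∑ i, c i + ∑ i, d i + ∑ i, e i := by
        rw [hbcde]; simp [Finset.sum_add_distrib]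
      omega
  have hterm : ∀ n ∈ posRoots hG, ∀ k : ℕ,
      0 ≤ (((μ + (k + 1) • rootVec G n) ⬝ᵥ n : ℤ) : ℚ) * V.coeff (μ + (k + 1) • rootVec G n) := by
    intro n hn k
    have hroot := (mem_posRoots hG).1 hn
    refine mul_nonneg ?_ ?_
    · have h1 := hμ.dotProduct_nonneg hroot.1
      rw [add_dotProduct, smul_dotProduct, hroot.2]
      positivity
    · have h1 : (k + 1) • rootVec G n = rootVec G (((k + 1 : ℕ) : ℤ) • n) := by
        rw [rootVec_smul, natCast_zsmul]
      rw [h1]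
      exact_mod_cast hnonneg _ (smul_nonneg (Int.natCast_nonneg _) hroot.1)
        (smul_ne_zero (show ((k + 1 : ℕ) : ℤ) ≠ 0 by positivity) hroot.ne_zero)
  have hUnonneg : ∀ n ∈ posRoots hG, ∀ k : ℕ, 0 ≤ (U n).coeff (μ + k • rootVec G n) := by
    intro n hn
    have hroot := (mem_posRoots hG).1 hn
    have hne : rootVec G n ≠ 0 := fun h =>
      hroot.ne_zero (rootVec_injective hG (h.trans (rootVec_zero G).symm))
    have hinj : Function.Injective fun k : ℕ => μ + k • rootVec G n := by
      intro k l hkl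
      have h1 : k • rootVec G n = l • rootVec G n := add_left_cancel hkl
      rw [← natCast_zsmul, ← natCast_zsmul] at h1
      exact_mod_cast smul_left_injective ℤ hne h1
    have hfin : {k : ℕ | (U n).coeff (μ + k • rootVec G n) ≠ 0}.Finite :=
      ((U n).coeff.hasFiniteSupport.preimage hinj.injOn).subset fun k hk => hk
    obtain ⟨K, hK⟩ := hfin.bddAbove
    have hd : ∀ d k : ℕ, K < k + d → 0 ≤ (U n).coeff (μ + k • rootVec G n) := by
      intro d
      induction d with
      | zero =>
        intro k hk
        by_contra h
        have := hK (show (U n).coeff (μ + k • rootVec G n) ≠ 0 from fun h0 => h h0.ge)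
        omega
      | succ d ihd =>
        intro k hk
        rw [hU n hn, add_assoc, ← succ_nsmul]
        exact add_nonneg (ihd (k + 1) (by omega)) (hterm n hn k)
    exact fun k => hd (K + 1) k (by omega)
  have hUzero : ∀ n ∈ posRoots hG, 0 ≤ (U n).coeff μ := fun n hn => by
    simpa using hUnonneg n hn 0
  obtain ⟨n, hn, hnb, hndom⟩ := exists_isPosRoot_isDominant_add hG hμ hb hb0 (hbeq ▸ hlam)
  have hnmem := (mem_posRoots hG).2 hn
  have hVn : 0 < V.coeff (μ + rootVec G n) := by
    refine ih _ ?_ hndom (b - n) (sub_nonneg.2 hnb) ?_ rfl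
    · have h1 := hsum_pos n hn.1 hn.ne_zero
      have h2 := hsum_pos b hb hb0
      have h3 : ∑ i, (b - n) i = ∑ i, b i - ∑ i, n i := by simp
      omega
    · rw [hbeq, rootVec_sub]; abel
  have hUpos : 0 < (U n).coeff μ := by
    rw [hU n hnmem]
    have h1 := hUnonneg n hnmem 1
    rw [one_smul] at h1
    refine add_pos_of_nonneg_of_pos h1 (mul_pos ?_ (by exact_mod_cast hVn))
    have h2 := hμ.dotProduct_nonneg hn.1
    rw [add_dotProduct, hn.2]
    exact_mod_cast (by omega : 0 < μ ⬝ᵥ n + 2)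
  have hrhs : 0 < ∑ n ∈ posRoots hG, (U n).coeff μ := Finset.sum_pos' hUzero ⟨n, hnmem, hUpos⟩
  have hfactor : 0 < form G (lam + rho) (lam + rho) - form G (μ + rho) (μ + rho) := by
    have h1 : lam + rho = μ + rho + rootVec G b := by rw [hbeq]; abel
    rw [h1, form_self_add_rootVec hG, add_sub_cancel_left]
    have h2 : 0 ≤ (μ + rho) ⬝ᵥ b := IsDominant.dotProduct_nonneg
      (fun i => add_nonneg (hμ i) zero_le_one) hb
    have h3 := rootVec_dotProduct_self_pos hG hb0
    exact_mod_cast (by omega : 0 < 2 * ((μ + rho) ⬝ᵥ b) + rootVec G b ⬝ᵥ b)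
  have hfin := hfreud μ
  have hprod : 0 < (form G (lam + rho) (lam + rho) - form G (μ + rho) (μ + rho)) *
      (V.coeff μ : ℚ) := by rw [hfin]; positivity
  exact_mod_cast pos_of_mul_pos_right hprod hfactor.le

theorem weightMult_domRep {lam : Weight I} (hlam : IsDominant lam) (ξ : Weight I) :
    weightMult G (domRep hG ξ) lam = weightMult G ξ lam := by
  obtain ⟨w, hw, hwξ⟩ := exists_weylGroup_apply_eq_domRep hG ξ
  rw [← hwξ]
  exact (weylCharacter_spec hG hlam).2.1.coeff_weylGroup hw ξ

theorem domRep_weightLE_of_weightMult_ne_zero {lam : Weight I} (hlam : IsDominant lam)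
    {ξ : Weight I} (h : weightMult G ξ lam ≠ 0) : WeightLE G (domRep hG ξ) lam := by
  rw [← weightMult_domRep hG hlam] at h
  exact (weylCharacter_spec hG hlam).2.2.1 _ h

theorem weightMult_nonneg {lam : Weight I} (hlam : IsDominant lam) (ξ : Weight I) :
    0 ≤ weightMult G ξ lam := by
  by_cases h : weightMult G ξ lam = 0
  · exact h.ge
  · rw [← weightMult_domRep hG hlam]
    exact (weightMult_pos hG hlam (isDominant_domRep hG ξ)
      (domRep_weightLE_of_weightMult_ne_zero hG hlam h)).le

end Freudenthal

/-! ### Gaussian binomial coefficients have coefficients in `ℕ` -/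

section Gauss

open Polynomial

theorem gaussBinom_zero_right (p : ℕ) : gaussBinom p 0 = 1 := by
  simpa [gaussDen, gaussNum] using gaussBinom_mul_gaussDen p 0

theorem gaussBinom_zero_left (m : ℕ) : gaussBinom 0 m = 1 := by
  apply mul_right_cancel₀ (gaussDen_monic m).ne_zero
  rw [gaussBinom_mul_gaussDen, one_mul]
  simp [gaussDen, gaussNum]

theorem gaussBinom_succ_succ (p m : ℕ) :
    gaussBinom (p + 1) (m + 1) =
      X ^ (m + 1) * gaussBinom p (m + 1) + gaussBinom (p + 1) m := by
  apply mul_right_cancel₀ (gaussDen_monic (m + 1)).ne_zero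
  have h1 : gaussNum (p + 1) (m + 1) = gaussNum (p + 1) m * (X ^ (p + m + 2) - 1) := by
    rw [gaussNum, Finset.prod_range_succ, gaussNum]; congr 3; ring
  have h2 : gaussNum p (m + 1) = gaussNum (p + 1) m * (X ^ (p + 1) - 1) := by
    rw [gaussNum, Finset.prod_range_succ', gaussNum]; congr 1
    exact Finset.prod_congr rfl fun j _ => by congr 2; ring
  have h3 : gaussDen (m + 1) = gaussDen m * (X ^ (m + 1) - 1) := Finset.prod_range_succ _ _
  rw [add_mul, mul_assoc, gaussBinom_mul_gaussDen, gaussBinom_mul_gaussDen, h3, ← mul_assoc,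
    gaussBinom_mul_gaussDen, h1, h2]
  ring

theorem exists_nat_gaussBinom (p m : ℕ) :
    ∃ g : ℕ[X], g.map (Nat.castRingHom ℤ) = gaussBinom p m ∧ g.coeff 0 = 1 ∧
      g.natDegree ≤ p * m := by
  induction m generalizing p with
  | zero => exact ⟨1, by simp [gaussBinom_zero_right], by simp, by simp⟩
  | succ m ihm =>
    induction p with
    | zero => exact ⟨1, by simp [gaussBinom_zero_left], by simp, by simp⟩
    | succ p ihp =>
      obtain ⟨g, hg1, -, hg3⟩ := ihp
      obtain ⟨h, hh1, hh2, hh3⟩ := ihm (p + 1)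
      refine ⟨X ^ (m + 1) * g + h, ?_, ?_, ?_⟩
      · simp [gaussBinom_succ_succ, hg1, hh1]
      · simp [hh2]
      · refine (natDegree_add_le _ _).trans (max_le ?_ (hh3.trans (by gcongr; omega)))
        refine natDegree_mul_le.trans ?_
        rw [natDegree_X_pow]
        linarith

end Gauss

/-! ### The tails of a configuration -/

section Config

/-- The coefficients `∑_{k > j} m_k^{(i)}` (`i ∈ I`). -/
def tail (m : Config I) (j : ℕ) : I → ℤ :=
  fun i => ∑ x ∈ m.support, if x.1 = i ∧ j < (x.2 : ℕ) then (m x : ℤ) else 0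

theorem tail_nonneg (m : Config I) (j : ℕ) : 0 ≤ tail m j := fun i =>
  Finset.sum_nonneg fun x _ => by split_ifs <;> positivity

theorem exists_forall_support_le (m : Config I) : ∃ N : ℕ, ∀ x ∈ m.support, (x.2 : ℕ) ≤ N :=
  ⟨m.support.sup fun x => (x.2 : ℕ), fun _ hx =>
    Finset.le_sup (f := fun x : I × ℕ+ => (x.2 : ℕ)) hx⟩

theorem tail_eq_zero {m : Config I} {N : ℕ} (hN : ∀ x ∈ m.support, (x.2 : ℕ) ≤ N) {j : ℕ}
    (hj : N ≤ j) : tail m j = 0 := by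
  ext i
  refine Finset.sum_eq_zero fun x hx => if_neg fun h => ?_
  have := hN x hx
  omega

theorem dotProduct_tail (φ : I → ℤ) (m : Config I) (j : ℕ) :
    φ ⬝ᵥ tail m j = ∑ x ∈ m.support, if j < (x.2 : ℕ) then φ x.1 * m x else 0 := by
  simp only [dotProduct, tail, Finset.mul_sum]
  rw [Finset.sum_comm]
  refine Finset.sum_congr rfl fun x _ => ?_
  rw [Finset.sum_eq_single x.1]
  · split_ifs <;> simp_all
  · intro i _ hi
    rw [if_neg fun h => hi h.1.symm, mul_zero]
  · simp

theorem sum_range_ite_lt (k l : ℕ) (c : ℤ) :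
    ∑ j ∈ Finset.range k, (if j < l then c else 0) = (min k l : ℕ) * c := by
  rw [← Finset.sum_filter, Finset.sum_const, nsmul_eq_mul]
  congr 2
  have : (Finset.range k).filter (· < l) = Finset.range (min k l) := by
    ext; simp
  rw [this, Finset.card_range]

/-- The tails of a configuration determine it. -/
theorem config_apply_eq (m : Config I) (i : I) (k : ℕ+) :
    (m (i, k) : ℤ) = tail m (k - 1) i - tail m k i := by
  have hk : 1 ≤ (k : ℕ) := k.pos
  rw [tail, tail, ← Finset.sum_sub_distrib]
  rw [Finset.sum_eq_single (i, k)]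
  · rw [if_pos ⟨rfl, by simp only; omega⟩, if_neg (by simp), sub_zero]
  · rintro ⟨i', k'⟩ _ hne
    simp only
    rw [sub_eq_zero]
    refine if_congr (and_congr_right fun hi => ?_) rfl rfl
    have : (k' : ℕ) ≠ k := fun h => hne (by rw [hi, PNat.coe_injective h])
    omega
  · intro h
    rw [Finsupp.notMem_support_iff.1 h]
    simp

theorem config_ext {m m' : Config I} (h : ∀ j, tail m j = tail m' j) : m = m' := by
  ext ⟨i, k⟩
  have h1 := config_apply_eq m i k
  rw [h, h, ← config_apply_eq m' i k] at h1
  exact_mod_cast h1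

/-- The configuration with `m_1^{(i)} = n i` and with `m_k^{(i)} = 0` for `k ≥ 2`. -/
def columnConfig (n : I → ℤ) : Config I :=
  Finsupp.onFinset (Finset.univ ×ˢ {1}) (fun x => if x.2 = 1 then (n x.1).toNat else 0)
    fun _ hx => Finset.mem_product.2 ⟨Finset.mem_univ _, Finset.mem_singleton.2
      (by_contra fun h => hx (if_neg h))⟩

theorem tail_columnConfig {n : I → ℤ} (hn : 0 ≤ n) (j : ℕ) :
    tail (columnConfig n) j = if j = 0 then n else 0 := by
  ext i
  have hsub : (columnConfig n).support ⊆ Finset.univ ×ˢ {1} := Finsupp.support_onFinset_subset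
  rw [tail, Finset.sum_subset hsub fun x _ hx => by
    rw [Finsupp.notMem_support_iff.1 hx]; simp]
  rw [Finset.sum_product]
  have hni : (0 : ℤ) ≤ n i := hn i
  by_cases hj : j = 0
  · simp [hj, columnConfig, hni]
  · simp [hj]

theorem sum_range_tail {m : Config I} {N : ℕ} (hN : ∀ x ∈ m.support, (x.2 : ℕ) ≤ N) (i : I) :
    ∑ j ∈ Finset.range N, tail m j i =
      ∑ x ∈ m.support, if x.1 = i then (x.2 : ℕ) * (m x : ℤ) else 0 := by
  simp only [tail]
  rw [Finset.sum_comm]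
  refine Finset.sum_congr rfl fun x hx => ?_
  split_ifs with h
  · simp only [h, true_and]
    rw [sum_range_ite_lt, min_eq_right (hN x hx)]
  · simp [h]

variable (G : SimpleGraph I) [DecidableRel G.Adj]

/-- The weight `ν - ∑_{j < k} ∑_i (∑_{l > j} m_l^{(i)}) α i`, whose coordinates are the vacancy
numbers `p_k^{(i)}`. -/
def vacancyWeight (ν : Weight I) (m : Config I) (k : ℕ) : Weight I :=
  ν - ∑ j ∈ Finset.range k, rootVec G (tail m j)

theorem vacancyWeight_zero (ν : Weight I) (m : Config I) : vacancyWeight G ν m 0 = ν := by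
  simp [vacancyWeight]

theorem vacancyWeight_succ (ν : Weight I) (m : Config I) (k : ℕ) :
    vacancyWeight G ν m (k + 1) = vacancyWeight G ν m k - rootVec G (tail m k) := by
  rw [vacancyWeight, Finset.sum_range_succ, vacancyWeight]; abel

theorem sum_range_rootVec_tail_apply (m : Config I) (k : ℕ) (i : I) :
    ∑ j ∈ Finset.range k, rootVec G (tail m j) i =
      ∑ y ∈ m.support, cartan G i y.1 * (min k y.2 : ℕ) * m y := by
  have h : ∀ j, rootVec G (tail m j) i =
      ∑ y ∈ m.support, if j < (y.2 : ℕ) then cartan G i y.1 * m y else 0 := fun j =>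
    dotProduct_tail (fun i' => cartan G i i') m j
  simp only [h]
  rw [Finset.sum_comm]
  refine Finset.sum_congr rfl fun y _ => ?_
  rw [sum_range_ite_lt]
  push_cast
  ring

theorem vacancy_eq (ν : Weight I) (m : Config I) (i : I) (k : ℕ+) :
    vacancy G ν m i k = vacancyWeight G ν m k i := by
  rw [vacancyWeight, Pi.sub_apply, Finset.sum_apply, sum_range_rootVec_tail_apply]
  rfl

theorem sum_smul_simpleRoot {m : Config I} {N : ℕ} (hN : ∀ x ∈ m.support, (x.2 : ℕ) ≤ N) :
    (m.sum fun x a => ((x.2 : ℕ) * a) • simpleRoot G x.1) =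
      ∑ j ∈ Finset.range N, rootVec G (tail m j) := by
  ext i
  rw [Finset.sum_apply, sum_range_rootVec_tail_apply, Finsupp.sum, Finset.sum_apply]
  refine Finset.sum_congr rfl fun y hy => ?_
  rw [min_eq_right (hN y hy), Pi.smul_apply, simpleRoot_apply, cartan_symm, nsmul_eq_mul]
  push_cast
  ring

variable {G} in
theorem admissible_iff {ν lam : Weight I} {m : Config I} {N : ℕ}
    (hN : ∀ x ∈ m.support, (x.2 : ℕ) ≤ N) :
    Admissible G ν lam m ↔
      (∀ k, IsDominant (vacancyWeight G ν m (k + 1))) ∧ vacancyWeight G ν m N = lam := by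
  rw [Admissible, sum_smul_simpleRoot G hN]
  refine and_congr ⟨fun h k i => ?_, fun h i k => ?_⟩ ?_
  · have := h i k.succPNat
    rwa [vacancy_eq] at this
  · have := h (k - 1) i
    rwa [Nat.sub_add_cancel k.pos, ← vacancy_eq] at this
  · rw [vacancyWeight, sub_eq_iff_eq_add, ← sub_eq_iff_eq_add', eq_comm]

theorem charge_eq (ν : Weight I) {m : Config I} {N : ℕ}
    (hN : ∀ x ∈ m.support, (x.2 : ℕ) ≤ N) :
    charge G ν m = ((∑ j ∈ Finset.range N, rootVec G (tail m j) ⬝ᵥ tail m j : ℤ) : ℚ) / 2 -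
      (ν ⬝ᵥ tail m 0 : ℤ) := by
  have h1 : (∑ j ∈ Finset.range N, rootVec G (tail m j) ⬝ᵥ tail m j : ℤ) =
      ∑ x ∈ m.support, ∑ y ∈ m.support, cartan G x.1 y.1 * (min x.2 y.2 : ℕ) * m x * m y := by
    simp only [dotProduct_tail]
    rw [Finset.sum_comm]
    refine Finset.sum_congr rfl fun x hx => ?_
    have h2 : ∀ j ∈ Finset.range N, (if j < (x.2 : ℕ) then rootVec G (tail m j) x.1 * (m x : ℤ)
        else 0) = (if j ∈ Finset.range x.2 then rootVec G (tail m j) x.1 * (m x : ℤ) else 0) := by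
      intro j _; simp
    rw [Finset.sum_congr rfl h2, ← Finset.sum_filter, Finset.filter_mem_eq_inter,
      Finset.inter_eq_right.2 (Finset.range_mono (hN x hx)), ← Finset.sum_mul,
      sum_range_rootVec_tail_apply, Finset.sum_mul]
    refine Finset.sum_congr rfl fun y _ => by push_cast; ring
  rw [h1, dotProduct_tail, charge]
  simp only [Finsupp.sum]
  push_cast
  congr 1
  · ring
  · refine Finset.sum_congr rfl fun x _ => ?_
    rw [if_pos x.2.pos]

theorem sum_vacancy_mul (ν : Weight I) {m : Config I} {N : ℕ}
    (hN : ∀ x ∈ m.support, (x.2 : ℕ) ≤ N) :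
    ∑ x ∈ m.support, vacancy G ν m x.1 x.2 * m x =
      ν ⬝ᵥ tail m 0 - ∑ j ∈ Finset.range N, rootVec G (tail m j) ⬝ᵥ tail m j := by
  have h1 : ∑ j ∈ Finset.range N, rootVec G (tail m j) ⬝ᵥ tail m j =
      ∑ x ∈ m.support, (∑ j ∈ Finset.range x.2, rootVec G (tail m j) x.1) * m x := by
    simp only [dotProduct_tail]
    rw [Finset.sum_comm]
    refine Finset.sum_congr rfl fun x hx => ?_
    have h2 : ∀ j ∈ Finset.range N, (if j < (x.2 : ℕ) then rootVec G (tail m j) x.1 * (m x : ℤ)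
        else 0) = (if j ∈ Finset.range x.2 then rootVec G (tail m j) x.1 * (m x : ℤ) else 0) := by
      intro j _; simp
    rw [Finset.sum_congr rfl h2, ← Finset.sum_filter, Finset.filter_mem_eq_inter,
      Finset.inter_eq_right.2 (Finset.range_mono (hN x hx)), ← Finset.sum_mul]
  rw [h1, dotProduct_tail, ← Finset.sum_sub_distrib]
  refine Finset.sum_congr rfl fun x _ => ?_
  rw [if_pos x.2.pos, vacancy_eq, vacancyWeight, Pi.sub_apply, Finset.sum_apply]
  ring

variable {G} (hG : IsADE G)
include hG

theorem form_self_sub_form_self_vacancyWeight (ν : Weight I) (m : Config I) (N : ℕ) :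
    form G ν ν - form G (vacancyWeight G ν m N) (vacancyWeight G ν m N) =
      ((∑ j ∈ Finset.range N, (2 * (vacancyWeight G ν m j ⬝ᵥ tail m j) -
        rootVec G (tail m j) ⬝ᵥ tail m j) : ℤ) : ℚ) := by
  induction N with
  | zero => simp [vacancyWeight_zero]
  | succ N ih =>
    rw [Finset.sum_range_succ, vacancyWeight_succ, form_self_sub_rootVec hG, Int.cast_add, ← ih]
    ring

/-- The exponent `(ν, ν) / 2 - (lam, lam) / 2 + c({m})` is the sum of the pairings of the weights
`p_j` of vacancy numbers, which are dominant, with the tails `∑_i ∑_{k > j} m_k^{(i)} α i`, for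
`j ≥ 1`. -/
theorem charge_add_eq {ν lam : Weight I} {m : Config I} {N : ℕ}
    (hN : ∀ x ∈ m.support, (x.2 : ℕ) ≤ N) (hm : Admissible G ν lam m) :
    form G ν ν / 2 - form G lam lam / 2 + charge G ν m =
      ((∑ j ∈ Finset.range N, vacancyWeight G ν m (j + 1) ⬝ᵥ tail m (j + 1) : ℤ) : ℚ) := by
  have hN' : ∀ x ∈ m.support, (x.2 : ℕ) ≤ N + 1 := fun x hx => (hN x hx).trans N.le_succ
  have h1 := form_self_sub_form_self_vacancyWeight hG ν m (N + 1)
  rw [((admissible_iff hN').1 hm).2, Finset.sum_sub_distrib, ← Finset.mul_sum] at h1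
  rw [charge_eq G ν hN']
  rw [Finset.sum_range_succ' (fun j => vacancyWeight G ν m j ⬝ᵥ tail m j),
    vacancyWeight_zero] at h1
  push_cast at h1 ⊢
  linarith

/-- The exponent of `charge_add_eq` is nonnegative, and it vanishes only if `m_k^{(i)} = 0` for
`k ≥ 2`: if `p_j` is orthogonal to the tail `β = ∑_i ∑_{k > j} m_k^{(i)} α i` then
`(p_{j+1}, β) = - (β, β)`, and this is nonnegative as `p_{j+1}` is dominant. -/
theorem exists_exponent {ν lam : Weight I} {m : Config I} (hm : Admissible G ν lam m) :
    ∃ e : ℕ, form G ν ν / 2 - form G lam lam / 2 + charge G ν m = e ∧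
      (e = 0 ↔ ∀ j, tail m (j + 1) = 0) := by
  obtain ⟨N, hN⟩ := exists_forall_support_le m
  have hdom := ((admissible_iff hN).1 hm).1
  have hnn : ∀ j ∈ Finset.range N, 0 ≤ vacancyWeight G ν m (j + 1) ⬝ᵥ tail m (j + 1) :=
    fun j _ => (hdom j).dotProduct_nonneg (tail_nonneg m _)
  obtain ⟨e, he⟩ := Int.eq_ofNat_of_zero_le (Finset.sum_nonneg hnn)
  refine ⟨e, by rw [charge_add_eq hG hN hm, he]; simp, fun h0 j => ?_, fun h => ?_⟩
  · rw [h0, Nat.cast_zero, Finset.sum_eq_zero_iff_of_nonneg hnn] at he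
    rcases lt_or_ge j N with hj | hj
    · have h1 := he j (Finset.mem_range.2 hj)
      have h2 := (hdom (j + 1)).dotProduct_nonneg (tail_nonneg m (j + 1))
      rw [vacancyWeight_succ, sub_dotProduct, h1, zero_sub] at h2
      exact (rootVec_dotProduct_self_eq_zero hG).1
        (le_antisymm (by omega) (rootVec_dotProduct_self_nonneg hG _))
    · exact tail_eq_zero hN (by omega)
  · rw [Finset.sum_eq_zero fun j _ => by rw [h j, dotProduct_zero]] at he
    exact_mod_cast he.symm

/-- The summand of the fermionic form has degree at most `0`: this degree is
`-(1/2) ∑_j (β_j, β_j)`, where `β_j` are the tails of `m`. -/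
theorem charge_add_sum_vacancy_nonpos (ν : Weight I) (m : Config I) :
    charge G ν m + ((∑ x ∈ m.support, vacancy G ν m x.1 x.2 * m x : ℤ) : ℚ) ≤ 0 := by
  obtain ⟨N, hN⟩ := exists_forall_support_le m
  rw [charge_eq G ν hN, sum_vacancy_mul G ν hN]
  have h : (0 : ℚ) ≤ (∑ j ∈ Finset.range N, rootVec G (tail m j) ⬝ᵥ tail m j : ℤ) := by
    exact_mod_cast Finset.sum_nonneg fun j _ => rootVec_dotProduct_self_nonneg hG _
  push_cast at h ⊢
  linarith

omit hG in
theorem Admissible.weightLE {ν lam : Weight I} {m : Config I} (hm : Admissible G ν lam m) :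
    WeightLE G lam ν := by
  obtain ⟨N, hN⟩ := exists_forall_support_le m
  refine (weightLE_iff G).2 ⟨∑ j ∈ Finset.range N, tail m j,
    Finset.sum_nonneg fun j _ => tail_nonneg m j, ?_⟩
  rw [← ((admissible_iff hN).1 hm).2, vacancyWeight, rootVec_sum, sub_add_cancel]

theorem finite_admissible (ν lam : Weight I) : {m | Admissible G ν lam m}.Finite := by
  by_cases hle : WeightLE G lam ν
  swap
  · exact Set.finite_empty.subset fun m hm => hle (Admissible.weightLE hm)
  obtain ⟨n, hn, hneq⟩ := (weightLE_iff G).1 hle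
  set b : ℕ := ∑ i, (n i).toNat with hb
  refine (Finset.finite_toSet (Finset.finsupp (Finset.univ ×ˢ Finset.Icc (1 : ℕ+) b.succPNat)
    fun _ => Finset.range (b + 1))).subset fun m hm => ?_
  have hm' : Admissible G ν lam m := hm
  obtain ⟨N, hN⟩ := exists_forall_support_le m
  have hsum : ∑ j ∈ Finset.range N, tail m j = n := by
    apply rootVec_injective hG
    have h1 := ((admissible_iff hN).1 hm').2
    rw [vacancyWeight, ← rootVec_sum, hneq, sub_eq_iff_eq_add] at h1
    exact (add_left_cancel h1).symm
  have hbound : ∀ x ∈ m.support, (x.2 : ℕ) * m x ≤ b := by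
    intro x hx
    have h1 : ((x.2 : ℕ) : ℤ) * m x ≤ n x.1 := by
      rw [← hsum, Finset.sum_apply, sum_range_tail hN]
      refine le_trans (by simp) (Finset.single_le_sum (f := fun y : I × ℕ+ =>
        if y.1 = x.1 then ((y.2 : ℕ) : ℤ) * m y else 0) (fun y _ => ?_) hx)
      split_ifs <;> positivity
    have h2 : (n x.1).toNat ≤ b :=
      Finset.single_le_sum (f := fun i => (n i).toNat) (fun _ _ => Nat.zero_le _)
        (Finset.mem_univ x.1)
    zify
    omega
  rw [SetLike.mem_coe, Finset.mem_finsupp_iff]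
  refine ⟨fun x hx => ?_, fun x _ => ?_⟩
  · simp only [Finset.mem_product, Finset.mem_univ, true_and, Finset.mem_Icc, one_le]
    have h1 := hbound x hx
    have h2 : 1 ≤ m x := Nat.one_le_iff_ne_zero.2 (Finsupp.mem_support_iff.1 hx)
    rw [← PNat.coe_le_coe, Nat.succPNat_coe]
    nlinarith [x.2.pos]
  · rw [Finset.mem_range]
    by_cases hx : x ∈ m.support
    · have h1 := hbound x hx
      have := x.2.pos
      nlinarith
    · rw [Finsupp.notMem_support_iff.1 hx]; omega

/-- For dominant `lam ≤ ν` there is exactly one admissible configuration with `m_k^{(i)} = 0` for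
`k ≥ 2`. -/
theorem exists_unique_admissible_column {ν lam : Weight I} (hlam : IsDominant lam)
    (hle : WeightLE G lam ν) :
    ∃ m₀, Admissible G ν lam m₀ ∧ (∀ j, tail m₀ (j + 1) = 0) ∧
      ∀ m, Admissible G ν lam m → (∀ j, tail m (j + 1) = 0) → m = m₀ := by
  obtain ⟨n, hn, rfl⟩ := (weightLE_iff G).1 hle
  have hvac : ∀ m : Config I, (∀ j, tail m (j + 1) = 0) → ∀ k,
      vacancyWeight G (lam + rootVec G n) m (k + 1) = lam + rootVec G n - rootVec G (tail m 0) := by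
    intro m hm k
    rw [vacancyWeight, Finset.sum_range_succ', Finset.sum_eq_zero fun j _ => by
      rw [hm j, rootVec_zero], zero_add]
  have htail : ∀ j, tail (columnConfig n) (j + 1) = 0 := fun j => by
    rw [tail_columnConfig hn, if_neg (Nat.succ_ne_zero j)]
  have h0 : tail (columnConfig n) 0 = n := by rw [tail_columnConfig hn, if_pos rfl]
  refine ⟨columnConfig n, ?_, htail, fun m hm hmt => config_ext fun j => ?_⟩
  · obtain ⟨N, hN⟩ := exists_forall_support_le (columnConfig n)
    have hvac' := hvac _ htail
    simp only [h0, add_sub_cancel_right] at hvac'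
    exact (admissible_iff fun x hx => (hN x hx).trans N.le_succ).2
      ⟨fun k => by rw [hvac']; exact hlam, hvac' N⟩
  · rcases j with _ | j
    · obtain ⟨N, hN⟩ := exists_forall_support_le m
      have h1 := ((admissible_iff fun x hx => (hN x hx).trans N.le_succ).1 hm).2
      rw [hvac m hmt, sub_eq_iff_eq_add] at h1
      rw [h0]
      exact (rootVec_injective hG (add_left_cancel h1)).symm
    · rw [hmt, htail]

end Config

/-! ### The character sum -/

section CharacterSum

open Polynomial

variable {G : SimpleGraph I} [DecidableRel G.Adj]

theorem qPow_mul (x y : ℚ) : qPow x * qPow y = qPow (x + y) := by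
  rw [qPow, qPow, AddMonoidAlgebra.single_mul_single, mul_one, qPow]

theorem aeval_qPow_X_pow (e : ℕ) : aeval (qPow 1) (X ^ e : ℕ[X]) = qPow e := by
  rw [map_pow, aeval_X, qPow, AddMonoidAlgebra.single_pow]
  simp [qPow]

theorem aeval_qPow_map (g : ℕ[X]) :
    aeval (qPow 1) (g.map (Nat.castRingHom ℤ)) = aeval (qPow 1) g :=
  aeval_map_algebraMap ℤ (qPow 1) g

/-- The summand `(ξ : V_lam) q^{(ν,ν)/2 - (ξ,ξ)/2 + c({m})} ∏ [p + m, m]` of the character sum. -/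
def summand (G : SimpleGraph I) [DecidableRel G.Adj] (ν ξ lam : Weight I) (m : Config I) : QRing :=
  weightMult G ξ lam • (qPow (form G ν ν / 2 - form G ξ ξ / 2) * (qPow (charge G ν m) *
    m.prod fun x a => aeval (qPow 1) (gaussBinom (vacancy G ν m x.1 x.2).toNat a)))

variable (hG : IsADE G)
include hG

theorem exists_half_form_sub_form (ξ : Weight I) {lam : Weight I}
    (hle : WeightLE G (domRep hG ξ) lam) :
    ∃ e : ℕ, form G lam lam / 2 - form G ξ ξ / 2 = e ∧ (e = 0 ↔ lam = domRep hG ξ) := by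
  obtain ⟨b, hb, rfl⟩ := (weightLE_iff G).1 hle
  obtain ⟨c, hc⟩ := rootVec_dotProduct_self_even G b
  have h1 := (isDominant_domRep hG ξ).dotProduct_nonneg hb
  have h2 := rootVec_dotProduct_self_nonneg hG b
  refine ⟨(domRep hG ξ ⬝ᵥ b + c).toNat, ?_, ?_⟩
  · rw [form_self_add_rootVec hG, form_domRep, hc, ← Int.cast_natCast (R := ℚ),
      Int.toNat_of_nonneg (by omega)]
    push_cast; ring
  · rw [Int.toNat_eq_zero]
    constructor
    · intro h
      rw [(rootVec_dotProduct_self_eq_zero hG).1 (by omega : rootVec G b ⬝ᵥ b = 0), rootVec_zero,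
        add_zero]
    · intro h
      rw [add_eq_left] at h
      rw [h, zero_dotProduct] at hc
      rw [rootVec_injective hG (h.trans (rootVec_zero G).symm), dotProduct_zero]
      omega

/-- The summands of the character sum are polynomials in `q` with coefficients in `ℕ`, of degree at
most `(ν, ν) / 2 - (ξ, ξ) / 2`. A constant term occurs only if `lam` is conjugate to `ξ` and
`m_k^{(i)} = 0` for `k ≥ 2`; the summand with `lam = ν` and `m = 0` is the monomial of top degree,
up to a factor. -/
theorem exists_nat_summand (ν ξ : Weight I) {lam : Weight I} (hlam : IsDominant lam)
    {m : Config I} (hm : Admissible G ν lam m) :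
    ∃ f : ℕ[X], summand G ν ξ lam m = aeval (qPow 1) f ∧
      (∀ d : ℕ, (d : ℚ) = form G ν ν / 2 - form G ξ ξ / 2 → f.natDegree ≤ d) ∧
      (lam = domRep hG ξ ∧ (∀ j, tail m (j + 1) = 0) → f.coeff 0 = 1) ∧
      (¬ (lam = domRep hG ξ ∧ ∀ j, tail m (j + 1) = 0) → f.coeff 0 = 0) ∧
      (m = 0 → weightMult G ξ lam ≠ 0 →
        ∀ d : ℕ, (d : ℚ) = form G ν ν / 2 - form G ξ ξ / 2 → f.coeff d ≠ 0) := by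
  by_cases hmult : weightMult G ξ lam = 0
  · refine ⟨0, by simp [summand, hmult], by simp, ?_, fun _ => coeff_zero _,
      fun _ h => absurd hmult h⟩
    rintro ⟨h, -⟩
    have := weightMult_pos hG hlam hlam (weightLE_refl G lam)
    rw [h, weightMult_domRep hG (isDominant_domRep hG ξ), ← h] at this
    omega
  obtain ⟨c, hc⟩ := Int.eq_ofNat_of_zero_le (weightMult_nonneg hG hlam ξ)
  obtain ⟨e₁, he₁, he₁'⟩ := exists_half_form_sub_form hG ξ
    (domRep_weightLE_of_weightMult_ne_zero hG hlam hmult)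
  obtain ⟨e₂, he₂, he₂'⟩ := exists_exponent hG hm
  choose g hg1 hg2 hg3 using exists_nat_gaussBinom
  set P : ℕ[X] := ∏ x ∈ m.support, g (vacancy G ν m x.1 x.2).toNat (m x) with hP
  have hP0 : P.coeff 0 = 1 := by
    rw [coeff_zero_eq_eval_zero, hP, eval_prod]
    exact Finset.prod_eq_one fun x _ => by rw [← coeff_zero_eq_eval_zero, hg2]
  have hexp : form G ν ν / 2 - form G ξ ξ / 2 + charge G ν m = ((e₁ + e₂ : ℕ) : ℚ) := by
    push_cast; rw [← he₁, ← he₂]; ring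
  refine ⟨c • (X ^ (e₁ + e₂) * P), ?_, ?_, fun h => ?_, fun h => ?_, ?_⟩
  · rw [summand, hc, ← mul_assoc, qPow_mul, hexp, map_nsmul, map_mul, aeval_qPow_X_pow, hP,
      map_prod, Finsupp.prod]
    simp only [← hg1, aeval_qPow_map]
    exact natCast_zsmul _ _
  · intro d hd
    refine (natDegree_smul_le _ _).trans (natDegree_mul_le.trans ?_)
    rw [natDegree_X_pow]
    have h1 : P.natDegree ≤ ∑ x ∈ m.support, (vacancy G ν m x.1 x.2).toNat * m x :=
      (natDegree_prod_le _ _).trans (Finset.sum_le_sum fun x _ => hg3 _ _)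
    have h2 : ((∑ x ∈ m.support, (vacancy G ν m x.1 x.2).toNat * m x : ℕ) : ℤ) =
        ∑ x ∈ m.support, vacancy G ν m x.1 x.2 * m x := by
      push_cast
      exact Finset.sum_congr rfl fun x _ => by rw [Int.toNat_of_nonneg (hm.1 x.1 x.2)]
    have h3 := charge_add_sum_vacancy_nonpos hG ν m
    rw [← h2, Int.cast_natCast] at h3
    rw [← hd] at hexp
    have h4 : ((e₁ + e₂ : ℕ) : ℚ) +
        ((∑ x ∈ m.support, (vacancy G ν m x.1 x.2).toNat * m x : ℕ) : ℚ) ≤ d := by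
      rw [← hexp]; linarith
    have h5 : e₁ + e₂ + ∑ x ∈ m.support, (vacancy G ν m x.1 x.2).toNat * m x ≤ d := by
      exact_mod_cast h4
    omega
  · have h0 : e₁ + e₂ = 0 := by rw [he₁'.2 h.1, he₂'.2 h.2]
    -- the weights conjugate to `lam` have multiplicity one in `V_lam`
    have hone : weightMult G ξ lam = 1 := by
      rw [← weightMult_domRep hG hlam, ← h.1]
      exact (weylCharacter_spec hG hlam).2.2.2
    have hc1 : c = 1 := by rw [hone] at hc; exact_mod_cast hc.symm
    rw [coeff_smul, coeff_X_pow_mul', h0, if_pos le_rfl, hP0, hc1, one_smul]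
  · have h0 : ¬ e₁ + e₂ ≤ 0 := fun hle => h ⟨he₁'.1 (by omega), he₂'.1 (by omega)⟩
    rw [coeff_smul, coeff_X_pow_mul', if_neg h0, smul_zero]
  · rintro rfl - d hd
    have hcharge : charge G ν (0 : Config I) = 0 := by simp [charge]
    rw [hcharge, add_zero, ← hd] at hexp
    have hde : d = e₁ + e₂ := by exact_mod_cast hexp
    rw [hde, coeff_smul, coeff_X_pow_mul', if_pos le_rfl, Nat.sub_self, hP0, smul_eq_mul, mul_one]
    rintro rfl
    exact hmult hc

theorem finite_dominant_weightLE (ν : Weight I) :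
    {lam | IsDominant lam ∧ WeightLE G lam ν}.Finite := by
  refine (finite_form_self_le hG (form G ν ν)).subset fun lam ⟨hlam, hle⟩ => ?_
  obtain ⟨e, he, -⟩ := exists_half_form_sub_form hG lam
    (lam := ν) (by rwa [domRep_of_isDominant hG hlam])
  have : (0 : ℚ) ≤ e := e.cast_nonneg
  rw [Set.mem_ofPred_eq]
  linarith

theorem characterSum_eq_sum (ν ξ : Weight I) :
    characterSum G ν ξ = ∑ lam ∈ (finite_dominant_weightLE hG ν).toFinset,
      ∑ m ∈ (finite_admissible hG ν lam).toFinset, summand G ν ξ lam m := by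
  have hform : ∀ lam, fermionicForm G ν lam = ∑ m ∈ (finite_admissible hG ν lam).toFinset,
      qPow (charge G ν m) *
        m.prod fun x a => aeval (qPow 1) (gaussBinom (vacancy G ν m x.1 x.2).toNat a) :=
    fun lam => finsum_cond_eq_sum_of_cond_iff _ fun {m} _ => by simp
  rw [characterSum, finsum_cond_eq_sum_of_cond_iff]
  · refine Finset.sum_congr rfl fun lam _ => ?_
    rw [hform, Finset.mul_sum, Finset.smul_sum]
    rfl
  · intro lam hne
    simp only [Set.Finite.mem_toFinset, Set.mem_ofPred_eq]
    refine ⟨fun h => ⟨h, ?_⟩, fun h => h.1⟩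
    by_contra hle
    refine hne ?_
    rw [hform, Finset.sum_eq_zero, mul_zero, smul_zero]
    intro m hm
    exact absurd (Admissible.weightLE (by simpa using hm)) hle

end CharacterSum

end FermionicForm

end

open FermionicForm in
theorem mainTheorem3 {I : Type*} [Fintype I] [DecidableEq I]
    (G : SimpleGraph I) [DecidableRel G.Adj] (hG : IsADE G)
    (ν : Weight I) (hν : IsDominant ν) (ξ : Weight I) :
    ∃ f : Polynomial ℕ,
      characterSum G ν ξ = Polynomial.aeval (qPow 1) f ∧
      (weightMult G ξ ν ≠ 0 → f.coeff 0 = 1) ∧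
      (IsDominant ξ → WeightLE G ξ ν →
        f.coeff 0 = 1 ∧ (f.natDegree : ℚ) = form G ν ν / 2 - form G ξ ξ / 2) := by
  classical
  have hsummand : ∀ lam : Weight I, ∀ m : Config I, ∃ f : Polynomial ℕ,
      IsDominant lam → Admissible G ν lam m → _ := fun lam m =>
    if h : IsDominant lam ∧ Admissible G ν lam m then
      (exists_nat_summand hG ν ξ h.1 h.2).imp fun f hf _ _ => hf
    else ⟨0, fun h1 h2 => absurd ⟨h1, h2⟩ h⟩
  choose f hf using hsummand
  set S := (finite_dominant_weightLE hG ν).toFinset with hS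
  have hmemS : ∀ {lam}, lam ∈ S ↔ IsDominant lam ∧ WeightLE G lam ν := by simp [hS]
  have hmemA : ∀ {lam m}, m ∈ (finite_admissible hG ν lam).toFinset ↔ Admissible G ν lam m := by
    simp
  -- the only constant term comes from the dominant conjugate `lam` of `ξ` and the unique admissible
  -- family with `m_k = 0` for `k ≥ 2`
  have hconst : WeightLE G (domRep hG ξ) ν →
      (∑ lam ∈ S, ∑ m ∈ (finite_admissible hG ν lam).toFinset, f lam m).coeff 0 = 1 := by
    intro hle
    have hdom := isDominant_domRep hG ξ
    obtain ⟨m₀, hm₀, hm₀t, huniq⟩ := exists_unique_admissible_column hG hdom hle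
    simp only [Polynomial.finsetSum_coeff]
    rw [Finset.sum_eq_single_of_mem _ (hmemS.2 ⟨hdom, hle⟩),
      Finset.sum_eq_single_of_mem _ (hmemA.2 hm₀)]
    · rw [(hf _ _ hdom hm₀).2.2.1 ⟨rfl, hm₀t⟩]
    · intro m hm hne
      rw [(hf _ _ hdom (hmemA.1 hm)).2.2.2.1 fun h => hne (huniq m (hmemA.1 hm) h.2)]
    · intro lam hlam hne
      refine Finset.sum_eq_zero fun m hm => ?_
      rw [(hf _ _ (hmemS.1 hlam).1 (hmemA.1 hm)).2.2.2.1 fun h => hne h.1]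
  refine ⟨∑ lam ∈ S, ∑ m ∈ (finite_admissible hG ν lam).toFinset, f lam m, ?_, ?_, ?_⟩
  · rw [characterSum_eq_sum hG ν, map_sum]
    refine Finset.sum_congr rfl fun lam hlam => ?_
    rw [map_sum]
    exact Finset.sum_congr rfl fun m hm => (hf _ _ (hmemS.1 hlam).1 (hmemA.1 hm)).1
  · exact fun h => hconst (domRep_weightLE_of_weightMult_ne_zero hG hν h)
  · intro hξ hle
    have hle' : WeightLE G (domRep hG ξ) ν := by rwa [domRep_of_isDominant hG hξ]
    refine ⟨hconst hle', ?_⟩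
    obtain ⟨d, hd, -⟩ := exists_half_form_sub_form hG ξ hle'
    rw [hd]
    congr 1
    refine Polynomial.natDegree_eq_of_le_of_coeff_ne_zero ?_ ?_
    · refine Polynomial.natDegree_sum_le_of_forall_le _ _ fun lam hlam =>
        Polynomial.natDegree_sum_le_of_forall_le _ _ fun m hm =>
          (hf _ _ (hmemS.1 hlam).1 (hmemA.1 hm)).2.1 d hd.symm
    · have h0 : Admissible G ν ν (0 : Config I) :=
        ⟨fun i k => by simpa [vacancy] using hν i, by simp⟩
      -- the coefficients lie in `ℕ`, so that the top monomial of this summand cannot cancel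
      have htop := (hf ν 0 hν h0).2.2.2.2 rfl (weightMult_pos hG hν hξ hle).ne' d hd.symm
      simp only [Polynomial.finsetSum_coeff]
      intro hzero
      rw [Finset.sum_eq_zero_iff] at hzero
      have h1 := hzero ν (hmemS.2 ⟨hν, weightLE_refl G ν⟩)
      rw [Finset.sum_eq_zero_iff] at h1
      exact htop (h1 0 (hmemA.2 h0))
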